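/- Let $G$ be a finite simple graph. A set $S\subseteq V(G)$ is $P_3$-closed if every vertex outside $S$ has fewer than two neighbours in $S$; the hull $\sigma(A)$ of $A\subseteq V(G)$ is the intersection of all $P_3$-closed sets containing $A$. In the connected $P_3$-game on $G$, two players move alternately, starting with the empty set $L$ of labeled vertices. A move selects an unlabeled vertex $x$ such that $\sigma(L\cup\{x\})$ induces a connected subgraph of $G$, and replaces $L$ by $\sigma(L\cup\{x\})$. A player who has no legal move loses. A graph is chordal if it has no induced cycle of length more than three, and biconnected if it is connected and has no cut vertex. (a) There is a polynomial-time algorithm that decides, given (the adjacency matrix of) a connected chordal graph $G$, whether the first player has a winning strategy in the connected $P_3$-game on $G$. That is, there are a random-access-machine program (registers and arrays of natural numbers, with addition, truncated subtraction and zero tests at unit cost) and a polynomial $p$ such that, on every connected chordal graph with $n$ vertices, the program halts after at most $p(n)$ steps with the correct answer. (b) If $G$ is a finite biconnected chordal graph and $x\ne y$ are vertices of $G$ at distance at most two, then $\sigma(\{x,y\})=V(G)$. -/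

import Mathlib

namespace P3Game

section Game

variable {V : Type*}

/-- A set `S` of vertices is `P₃`-closed if every vertex outside `S` has fewer than two
neighbours in `S`. -/
def P3Closed (G : SimpleGraph V) (S : Set V) : Prop :=
  ∀ x, x ∉ S → (G.neighborSet x ∩ S).encard < 2

/-- The hull of `A`: the intersection of all `P₃`-closed sets that contain `A`. -/
def hull (G : SimpleGraph V) (A : Set V) : Set V :=
  ⋂₀ {K | P3Closed G K ∧ A ⊆ K}

/-- The legal moves of the connected `P₃`-game: from the set `L` of labeled vertices, the player
selects an unlabeled vertex `x` such that the hull of `L + x` induces a connected subgraph, and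
this hull becomes the new set of labeled vertices. -/
def ConnMove (G : SimpleGraph V) (L L' : Set V) : Prop :=
  ∃ x, x ∉ L ∧ (G.induce (hull G (insert x L))).Connected ∧ L' = hull G (insert x L)

/-- The player who is to move has a winning strategy when `L` is the set of labeled vertices: some
legal move leads to a position in which every legal reply of the opponent leads again to a position
that is winning for the player to move. A player without a legal move loses. -/
inductive MoverWins (G : SimpleGraph V) : Set V → Prop
  | intro (L L' : Set V) (hmove : ConnMove G L L')
      (hreply : ∀ L'', ConnMove G L' L'' → MoverWins G L'') : MoverWins G L

/-- The first player has a winning strategy in the connected `P₃`-game on `G`. Initially no vertex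
is labeled. -/
def FirstPlayerWins (G : SimpleGraph V) : Prop :=
  MoverWins G ∅

/-- No induced cycle of length more than three. -/
def IsChordal (G : SimpleGraph V) : Prop :=
  ∀ k : ℕ, 3 < k → ¬ (SimpleGraph.cycleGraph k).IsIndContained G

/-- Connected, and without a cut vertex. -/
def IsBiconnected (G : SimpleGraph V) : Prop :=
  G.Connected ∧ ∀ v : V, (G.induce ({v}ᶜ : Set V)).Preconnected

end Game

/-! The machine model is a random-access machine, programmed with structured control flow.
It has registers and arrays of natural numbers, the instructions of a program name finitely many
of them, and the arithmetic is addition and truncated subtraction, at unit cost. There is no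
multiplication, so that running times are polynomially related to those of Turing machines. -/

/-- A memory state: numbered registers, and numbered arrays whose cells are addressed by natural
numbers. -/
structure Store where
  reg : ℕ → ℕ
  arr : ℕ → ℕ → ℕ

/-- Arithmetic expressions. `get A e` reads the cell of array `A` whose address is the value of
`e`. -/
inductive Expr
  | const (k : ℕ)
  | var (x : ℕ)
  | get (A : ℕ) (e : Expr)
  | add (e f : Expr)
  | sub (e f : Expr)

/-- The value of an expression. -/
def Expr.eval (s : Store) : Expr → ℕ
  | .const k => k
  | .var x => s.reg x
  | .get A e => s.arr A (e.eval s)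
  | .add e f => e.eval s + f.eval s
  | .sub e f => e.eval s - f.eval s

/-- The number of steps that the evaluation of an expression takes: one for each constant, each
register access, each array access and each arithmetic operation. -/
def Expr.cost : Expr → ℕ
  | .const _ => 1
  | .var _ => 1
  | .get _ e => e.cost + 1
  | .add e f => e.cost + f.cost + 1
  | .sub e f => e.cost + f.cost + 1

/-- Programs. -/
inductive Prog
  | skip
  | assign (x : ℕ) (e : Expr)
  | put (A : ℕ) (i e : Expr)
  | seq (c d : Prog)
  | ite (e : Expr) (c d : Prog)
  | loop (e : Expr) (c : Prog)

/-- The state after storing `v` in register `x`. -/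
def Store.setReg (s : Store) (x v : ℕ) : Store :=
  { s with reg := Function.update s.reg x v }

/-- The state after storing `v` in cell `i` of array `A`. -/
def Store.setArr (s : Store) (A i v : ℕ) : Store :=
  { s with arr := Function.update s.arr A (Function.update (s.arr A) i v) }

/-- `Runs c s s' t`: started in the state `s`, the program `c` halts in the state `s'` after
exactly `t` steps. The condition of `ite` and `loop` holds if the value of the expression is not
zero; `loop e c` repeats `c` as long as the condition `e` holds. -/
inductive Runs : Prog → Store → Store → ℕ → Prop
  | skip (s : Store) : Runs .skip s s 1
  | assign (x : ℕ) (e : Expr) (s : Store) :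
      Runs (.assign x e) s (s.setReg x (e.eval s)) (e.cost + 1)
  | put (A : ℕ) (i e : Expr) (s : Store) :
      Runs (.put A i e) s (s.setArr A (i.eval s) (e.eval s)) (i.cost + e.cost + 1)
  | seq {c d : Prog} {s s' s'' : Store} {t t' : ℕ}
      (hc : Runs c s s' t) (hd : Runs d s' s'' t') : Runs (.seq c d) s s'' (t + t')
  | iteTrue {e : Expr} {c d : Prog} {s s' : Store} {t : ℕ}
      (he : e.eval s ≠ 0) (hc : Runs c s s' t) : Runs (.ite e c d) s s' (e.cost + 1 + t)
  | iteFalse {e : Expr} {c d : Prog} {s s' : Store} {t : ℕ}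
      (he : e.eval s = 0) (hd : Runs d s s' t) : Runs (.ite e c d) s s' (e.cost + 1 + t)
  | loopDone {e : Expr} {c : Prog} {s : Store}
      (he : e.eval s = 0) : Runs (.loop e c) s s (e.cost + 1)
  | loopStep {e : Expr} {c : Prog} {s s' s'' : Store} {t t' : ℕ}
      (he : e.eval s ≠ 0) (hc : Runs c s s' t) (hl : Runs (.loop e c) s' s'' t') :
      Runs (.loop e c) s s'' (e.cost + 1 + t + t')

/-- Programs are deterministic. -/
theorem Runs.deterministic {c : Prog} {s s₁ s₂ : Store} {t₁ t₂ : ℕ}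
    (h₁ : Runs c s s₁ t₁) (h₂ : Runs c s s₂ t₂) : s₁ = s₂ ∧ t₁ = t₂ := by
  induction h₁ generalizing s₂ t₂ with
  | skip s => cases h₂; exact ⟨rfl, rfl⟩
  | assign x e s => cases h₂; exact ⟨rfl, rfl⟩
  | put A i e s => cases h₂; exact ⟨rfl, rfl⟩
  | seq hc hd ihc ihd =>
    cases h₂ with
    | seq hc₂ hd₂ =>
      obtain ⟨rfl, rfl⟩ := ihc hc₂
      obtain ⟨rfl, rfl⟩ := ihd hd₂
      exact ⟨rfl, rfl⟩
  | iteTrue he hc ih =>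
    cases h₂ with
    | iteTrue he₂ hc₂ => obtain ⟨rfl, rfl⟩ := ih hc₂; exact ⟨rfl, rfl⟩
    | iteFalse he₂ hd₂ => exact absurd he₂ he
  | iteFalse he hd ih =>
    cases h₂ with
    | iteTrue he₂ hc₂ => exact absurd he he₂
    | iteFalse he₂ hd₂ => obtain ⟨rfl, rfl⟩ := ih hd₂; exact ⟨rfl, rfl⟩
  | loopDone he =>
    cases h₂ with
    | loopDone he₂ => exact ⟨rfl, rfl⟩
    | loopStep he₂ hc₂ hl₂ => exact absurd he he₂
  | loopStep he hc hl ihc ihl =>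
    cases h₂ with
    | loopDone he₂ => exact absurd he₂ he
    | loopStep he₂ hc₂ hl₂ =>
      obtain ⟨rfl, rfl⟩ := ihc hc₂
      obtain ⟨rfl, rfl⟩ := ihl hl₂
      exact ⟨rfl, rfl⟩

open Classical in
/-- The input: register `0` holds the number `n` of vertices, cell `u * n + v` of array `0` holds
the entry of the adjacency matrix of `G` in row `u` and column `v`, and all else is zero. -/
noncomputable def inputStore {n : ℕ} (G : SimpleGraph (Fin n)) : Store where
  reg := fun x => if x = 0 then n else 0
  arr := fun A i =>
    if A = 0 ∧ ∃ u v : Fin n, G.Adj u v ∧ i = (u : ℕ) * n + (v : ℕ) then 1 else 0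

/-- On input `G`, the program `c` halts within `T` steps, with the answer in register `0`:
`1` if `P` holds, and `0` otherwise. -/
def Prog.DecidesWithin {n : ℕ} (c : Prog) (G : SimpleGraph (Fin n)) (P : Prop) (T : ℕ) : Prop :=
  ∃ (s : Store) (t : ℕ), Runs c (inputStore G) s t ∧ t ≤ T ∧
    (P → s.reg 0 = 1) ∧ (¬ P → s.reg 0 = 0)

/-- There is a polynomial-time algorithm that decides, for the finite graphs in the class `C`,
whether they have the property `P`. One program and one polynomial in the number of vertices
serve all graphs in the class. -/
def PolyTimeDecidableOn (C P : ∀ {n : ℕ}, SimpleGraph (Fin n) → Prop) : Prop :=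
  ∃ (c : Prog) (p : Polynomial ℕ), ∀ (n : ℕ) (G : SimpleGraph (Fin n)),
    C G → c.DecidesWithin G (P G) (p.eval n)

end P3Game

/-! Call a nonempty `P₃`-closed set that induces a connected subgraph connected-closed
(`ConnClosed`). Everything rests on one fact about a connected chordal graph: each component of the
complement of a connected-closed set `L` is attached to `L` at a single vertex `u`
(`attachment_unique`, `ConnClosed.exists_attachment`), so it is a component of `G - u`, called a
branch at `u`. Indeed, let a path outside `L` join neighbours of two distinct vertices of `L`. Its
first vertex has only one neighbour in `L`, since `L` is closed, and the path closes up through `L`;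
chordality then forces a chord which shortens the path, down to a vertex with two neighbours in `L`.

Part (b) follows. Two vertices at distance at most two have a connected-closed hull. If it missed a
vertex, it would be separated from that vertex by a single vertex `u`, apart from `u` itself;
without cut vertices the hull would be `{u}`.

For part (a), the positions after the first move are connected-closed, and a move is an unlabeled
vertex within two steps of `L` (`connMove_iff`). A move inside a branch at `u ∈ L` affects only that
branch, and its effect does not depend on the rest of `L` (`hull_insert_eq`). Thus a position is a
disjoint sum of games, one for each branch attached to `L`, and by Sprague–Grundy theory the mover
wins iff the nim-sum of the branch values is not zero (`moverWins_iff_nimSum_ne_zero`). There are at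
most `n ^ 2` branches. The value of a branch is the least number that is not a nim-sum over the
smaller branches left by a move in it; it has fewer than `n` options, so `n` rounds of simultaneous
evaluation give all values (`grundyIter_eq`). The first player wins iff some `{x}` has nim-sum zero.

To obtain a machine program, the algorithm is written in a language `Tm` whose only loops run over
`0, …, n - 1`. Every well-formed term compiles to a program with a polynomial time bound
(`Tm.Wf.computable`). Branches and hulls are computed as `n`-fold iterates of one-step closures,
nim-sums bit by bit as parities. -/

namespace P3Game

/-! ### Hulls, attachment in chordal graphs, legal moves, and part (b) -/

section Graph

variable {V : Type*} {G : SimpleGraph V}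

theorem p3Closed_iff {S : Set V} : P3Closed G S ↔
    ∀ x a b, G.Adj x a → G.Adj x b → a ∈ S → b ∈ S → a ≠ b → x ∈ S := by
  have key : ∀ x, (G.neighborSet x ∩ S).encard < 2 ↔
      ∀ a b, a ∈ G.neighborSet x ∩ S → b ∈ G.neighborSet x ∩ S → a = b := by
    intro x
    rw [← Set.encard_le_one_iff, ← ENat.lt_add_one_iff (by simp)]
    norm_num
  constructor
  · intro h x a b hxa hxb ha hb hab
    by_contra hx
    exact hab ((key x).1 (h x hx) a b ⟨hxa, ha⟩ ⟨hxb, hb⟩)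
  · intro h x hx
    rw [key]
    rintro a b ⟨hxa, ha⟩ ⟨hxb, hb⟩
    by_contra hab
    exact hx (h x a b hxa hxb ha hb hab)

theorem subset_hull (G : SimpleGraph V) (A : Set V) : A ⊆ hull G A :=
  Set.subset_sInter fun _ h => h.2

theorem hull_subset {A K : Set V} (hK : P3Closed G K) (hA : A ⊆ K) : hull G A ⊆ K :=
  Set.sInter_subset_of_mem ⟨hK, hA⟩

theorem p3Closed_hull (G : SimpleGraph V) (A : Set V) : P3Closed G (hull G A) := by
  rw [p3Closed_iff]
  intro x a b hxa hxb ha hb hab K hK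
  exact p3Closed_iff.1 hK.1 x a b hxa hxb (ha K hK) (hb K hK) hab

theorem hull_eq_self {S : Set V} (h : P3Closed G S) : hull G S = S :=
  (hull_subset h subset_rfl).antisymm (subset_hull G S)

theorem p3Closed_singleton (x : V) : P3Closed G {x} := by
  rw [p3Closed_iff]
  rintro v a b - - rfl rfl h
  exact absurd rfl h

/-- There is a walk from `a` to `b` all of whose vertices after `a` lie in `S`. -/
def ReachIn (G : SimpleGraph V) (S : Set V) : V → V → Prop :=
  Relation.ReflTransGen fun a b => G.Adj a b ∧ b ∈ S

theorem ReachIn.mono {S T : Set V} (h : S ⊆ T) {a b : V} (hab : ReachIn G S a b) :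
    ReachIn G T a b :=
  Relation.ReflTransGen.mono (fun _ _ h' => ⟨h'.1, h h'.2⟩) _ _ hab

theorem ReachIn.mem {S : Set V} {a b : V} (hab : ReachIn G S a b) (ha : a ∈ S) : b ∈ S := by
  induction hab with
  | refl => exact ha
  | tail _ h _ => exact h.2

theorem ReachIn.symm {S : Set V} {a b : V} (hab : ReachIn G S a b) (ha : a ∈ S) :
    ReachIn G S b a := by
  induction hab with
  | refl => exact .refl
  | tail h h' ih => exact .head ⟨h'.1.symm, ReachIn.mem h ha⟩ ih

theorem preconnected_induce_iff {S : Set V} :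
    (G.induce S).Preconnected ↔ ∀ a ∈ S, ∀ b ∈ S, ReachIn G S a b := by
  constructor
  · intro h a ha b hb
    obtain ⟨p⟩ := h ⟨a, ha⟩ ⟨b, hb⟩
    have : ∀ u v : S, (G.induce S).Walk u v → ReachIn G S u v := by
      intro u v p
      induction p with
      | nil => exact .refl
      | @cons u v w huv _ ih => exact .head ⟨huv, v.2⟩ ih
    exact this _ _ p
  · rintro h ⟨a, ha⟩ ⟨b, hb⟩
    have hab := h a ha b hb
    have : ∀ hb' : b ∈ S, (G.induce S).Reachable ⟨a, ha⟩ ⟨b, hb'⟩ := by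
      clear hb
      induction hab with
      | refl => exact fun _ => .refl _
      | @tail c d h₁ h₂ ih =>
        intro hd
        have hc := ReachIn.mem h₁ ha
        refine (ih hc).trans (SimpleGraph.Adj.reachable ?_)
        exact h₂.1
    exact this hb

/-- A walk given by its sequence of vertices. -/
theorem ReachIn.exists_seq {S : Set V} {a b : V} (hab : ReachIn G S a b) :
    ∃ (k : ℕ) (f : ℕ → V), f 0 = a ∧ f k = b ∧ (∀ i < k, G.Adj (f i) (f (i + 1))) ∧
      ∀ i, 0 < i → i ≤ k → f i ∈ S := by
  induction hab with
  | refl => exact ⟨0, fun _ => a, rfl, rfl, by simp, by intro i; omega⟩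
  | @tail c d h₁ h₂ ih =>
    obtain ⟨k, f, h0, hk, hadj, hS⟩ := ih
    refine ⟨k + 1, fun i => if i ≤ k then f i else d, by simp [h0], by simp, ?_, ?_⟩
    · intro i hi
      rcases Nat.lt_succ_iff_lt_or_eq.1 hi with hi | rfl
      · simpa [hi.le, Nat.succ_le_of_lt hi] using hadj i hi
      · simpa [hk] using h₂.1
    · intro i hi hik
      by_cases h : i ≤ k
      · simpa [h] using hS i hi h
      · simpa [h] using h₂.2

theorem cycleGraph_adj_iff {k : ℕ} (hk : 2 ≤ k) (i j : Fin (k + 2)) :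
    (SimpleGraph.cycleGraph (k + 2)).Adj i j ↔
      i.val + 1 = j.val ∨ j.val + 1 = i.val ∨ (i.val = 0 ∧ j.val = k + 1) ∨
        (j.val = 0 ∧ i.val = k + 1) := by
  rw [SimpleGraph.cycleGraph_adj', Fin.sub_def, Fin.sub_def]
  have := i.2
  have := j.2
  simp only
  rcases lt_trichotomy i.val j.val with h | h | h
  · rw [Nat.mod_eq_of_lt (a := k + 2 - j + i) (by omega),
      show k + 2 - i.val + j.val = (j.val - i.val) + (k + 2) by omega, Nat.add_mod_right,
      Nat.mod_eq_of_lt (by omega)]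
    omega
  · rw [h, Nat.sub_add_cancel (by omega), Nat.mod_self]
    omega
  · rw [Nat.mod_eq_of_lt (a := k + 2 - i + j) (by omega),
      show k + 2 - j.val + i.val = (i.val - j.val) + (k + 2) by omega, Nat.add_mod_right,
      Nat.mod_eq_of_lt (by omega)]
    omega

/-- In a chordal graph, two neighbours of `v` that are joined by a walk whose inner vertices
are neither equal nor adjacent to `v` are adjacent. -/
theorem IsChordal.adj_of_reachIn (hG : IsChordal G) {v a b : V} (hva : G.Adj v a)
    (hvb : G.Adj v b) (hab : a ≠ b)
    (h : ReachIn G {x | x = b ∨ (x ≠ v ∧ ¬ G.Adj v x)} a b) : G.Adj a b := by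
  classical
  let P : ℕ → Prop := fun k => ∃ f : ℕ → V, f 0 = a ∧ f k = b ∧
    (∀ i < k, G.Adj (f i) (f (i + 1))) ∧ ∀ i, 0 < i → i < k → f i ≠ v ∧ ¬ G.Adj v (f i)
  have hP : ∃ k, P k := by
    obtain ⟨k, f, h0, hk, hadj, hS⟩ := h.exists_seq
    -- The vertex `b` itself is allowed inside the walk, so the walk is cut at its first visit to
    -- `b`.
    have hex : ∃ m, m ≤ k ∧ f m = b := ⟨k, le_rfl, hk⟩
    refine ⟨Nat.find hex, f, h0, (Nat.find_spec hex).2, fun i hi =>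
      hadj i (hi.trans_le (Nat.find_spec hex).1), fun i hi hik => ?_⟩
    have hle := hik.le.trans (Nat.find_spec hex).1
    rcases hS i hi hle with h' | h'
    · exact absurd ⟨hle, h'⟩ (Nat.find_min hex hik)
    · exact h'
  obtain ⟨f, h0, hk, hadj, hS⟩ := Nat.find_spec hP
  have hmin : ∀ m, P m → Nat.find hP ≤ m := fun m hm => Nat.find_min' hP hm
  generalize Nat.find hP = k at *
  -- A shortest such walk repeats no vertex and has no chord: otherwise the part in between could be
  -- cut out.
  have hne : ∀ i j, i < j → j ≤ k → f i ≠ f j := by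
    intro i j hij hjk heq
    have : k ≤ k - (j - i) := by
      refine hmin _ ⟨fun t => if t ≤ i then f t else f (t + (j - i)), by simp [h0], ?_, ?_, ?_⟩
      · dsimp only
        split_ifs with h'
        · rw [show k - (j - i) = i by omega, heq, ← hk]; congr 1; omega
        · rw [← hk]; congr 1; omega
      · intro t ht
        dsimp only
        split_ifs with h1 h2 h2
        · exact hadj t (by omega)
        · obtain rfl : t = i := by omega
          rw [heq, show t + 1 + (j - t) = j + 1 by omega]
          exact hadj j (by omega)
        · omega
        · rw [show t + 1 + (j - i) = t + (j - i) + 1 by omega]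
          exact hadj _ (by omega)
      · intro t ht htk
        dsimp only
        split_ifs with h1
        · exact hS t ht (by omega)
        · exact hS _ (by omega) (by omega)
    omega
  have hnadj : ∀ i j, i + 1 < j → j ≤ k → ¬ G.Adj (f i) (f j) := by
    intro i j hij hjk heq
    have : k ≤ k - (j - i - 1) := by
      refine hmin _ ⟨fun t => if t ≤ i then f t else f (t + (j - i - 1)), by simp [h0], ?_, ?_, ?_⟩
      · dsimp only
        rw [if_neg (by omega), ← hk]; congr 1; omega
      · intro t ht
        dsimp only
        split_ifs with h1 h2 h2
        · exact hadj t (by omega)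
        · obtain rfl : t = i := by omega
          rwa [show t + 1 + (j - t - 1) = j by omega]
        · omega
        · rw [show t + 1 + (j - i - 1) = t + (j - i - 1) + 1 by omega]
          exact hadj _ (by omega)
      · intro t ht htk
        dsimp only
        split_ifs with h1
        · exact hS t ht (by omega)
        · exact hS _ (by omega) (by omega)
    omega
  by_contra hnab
  have hk2 : 2 ≤ k := by
    rcases k with _ | _ | k
    · exact absurd (h0.symm.trans hk) hab
    · exact absurd (h0 ▸ hk ▸ hadj 0 (by omega)) hnab
    · omega
  have hv : ∀ i ≤ k, f i ≠ v := by
    intro i hi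
    rcases Nat.eq_zero_or_pos i with rfl | hi0
    · rw [h0]; exact hva.ne'
    rcases hi.lt_or_eq with hi' | rfl
    · exact (hS i hi0 hi').1
    · rw [hk]; exact hvb.ne'
  have hvadj : ∀ i ≤ k, G.Adj (f i) v ↔ i = 0 ∨ i = k := by
    intro i hi
    constructor
    · intro h'
      by_contra! hc
      exact (hS i (by omega) (by omega)).2 h'.symm
    · rintro (rfl | rfl)
      · rw [h0]; exact hva.symm
      · rw [hk]; exact hvb.symm
  have hff : ∀ i j, i ≤ k → j ≤ k → (G.Adj (f i) (f j) ↔ i + 1 = j ∨ j + 1 = i) := by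
    intro i j hi hj
    constructor
    · intro h'
      rcases lt_trichotomy i j with hij | rfl | hij
      · by_contra hc; exact hnadj i j (by omega) hj h'
      · exact absurd h' (G.loopless.irrefl _)
      · by_contra hc; exact hnadj j i (by omega) hi h'.symm
    · rintro (rfl | rfl)
      · exact hadj i (by omega)
      · exact (hadj j (by omega)).symm
  -- The vertices `f 0, …, f k`, followed by `v` at index `k + 1`, form an induced cycle of length
  -- `k + 2 ≥ 4`.
  refine hG (k + 2) (by omega) ⟨⟨⟨fun i => if i.val ≤ k then f i else v, ?_⟩, ?_⟩⟩
  · intro i j hij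
    have := i.2
    have := j.2
    dsimp only at hij
    apply Fin.ext
    split_ifs at hij with h1 h2 h2
    · by_contra hne'
      rcases lt_or_gt_of_ne hne' with h' | h'
      · exact hne _ _ h' h2 hij
      · exact hne _ _ h' h1 hij.symm
    · exact absurd hij (hv _ h1)
    · exact absurd hij.symm (hv _ h2)
    · omega
  · intro i j
    have := i.2
    have := j.2
    rw [cycleGraph_adj_iff hk2]
    change G.Adj (if i.val ≤ k then f i else v) (if j.val ≤ k then f j else v) ↔ _
    split_ifs with h1 h2 h2
    · rw [hff _ _ h1 h2]; omega
    · rw [hvadj _ h1]; omega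
    · rw [SimpleGraph.adj_comm, hvadj _ h2]; omega
    · simp only [SimpleGraph.irrefl, false_iff]; omega

/-- A nonempty `P₃`-closed set that induces a connected subgraph. -/
structure ConnClosed (G : SimpleGraph V) (L : Set V) : Prop where
  closed : P3Closed G L
  conn : ∀ a ∈ L, ∀ b ∈ L, ReachIn G L a b
  nonempty : L.Nonempty

theorem ConnClosed.singleton (x : V) : ConnClosed G {x} :=
  ⟨p3Closed_singleton x, by rintro _ rfl _ rfl; exact .refl, Set.singleton_nonempty x⟩

/-- The component of `w` in `G - u`. -/
def branch (G : SimpleGraph V) (u w : V) : Set V :=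
  {v | ReachIn G {u}ᶜ w v}

/-- Induction on the length of a walk outside `L` between neighbours of `a` and `b`. As `L` is
closed, `a` is the only neighbour of `f 0` in `L`, which settles length zero. Any return to `f 0` or
to a neighbour of `f 0` after `f 1` gives a shorter walk. Otherwise chordality makes `f 1` adjacent
to `a`, and `f 0` can be dropped. -/
theorem attachment_unique (hG : IsChordal G) {L : Set V} (hL : ConnClosed G L) :
    ∀ (k : ℕ) (f : ℕ → V) (a b : V), (∀ i < k, G.Adj (f i) (f (i + 1))) →
      (∀ i ≤ k, f i ∉ L) → a ∈ L → b ∈ L → G.Adj (f 0) a → G.Adj (f k) b → a = b := by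
  intro k
  induction k using Nat.strong_induction_on with
  | _ k ih =>
  intro f a b hadj hfL ha hb hfa hfb
  by_contra hab
  have huniq : ∀ x ∈ L, G.Adj (f 0) x → x = a := by
    intro x hx hfx
    by_contra hxa
    exact hfL 0 (Nat.zero_le _) (p3Closed_iff.1 hL.closed _ _ _ hfx hfa hx ha hxa)
  rcases Nat.eq_zero_or_pos k with rfl | hk
  · exact hab (huniq b hb hfb).symm
  have hshort : ∀ i, 2 ≤ i → i ≤ k → ¬ G.Adj (f 0) (f i) := by
    intro i hi hik h
    refine hab (ih (k - i + 1) (by omega) (fun t => if t = 0 then f 0 else f (t + i - 1)) a b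
      ?_ ?_ ha hb (by simpa using hfa) ?_)
    · intro t ht
      rcases Nat.eq_zero_or_pos t with rfl | ht0
      · simpa using h
      · simp only [ht0.ne', if_false, Nat.succ_ne_zero]
        rw [show t + 1 + i - 1 = t + i - 1 + 1 by omega]
        exact hadj _ (by omega)
    · intro t ht
      split_ifs
      · exact hfL 0 (by omega)
      · exact hfL _ (by omega)
    · simp only [Nat.succ_ne_zero, if_false]
      rwa [show k - i + 1 + i - 1 = k by omega]
  have hneq : ∀ i, 2 ≤ i → i ≤ k → f i ≠ f 0 := by
    intro i hi hik h
    refine hab (ih (k - i) (by omega) (fun t => f (t + i)) a b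
      ?_ ?_ ha hb (by simpa [h] using hfa) ?_)
    · intro t ht
      rw [show t + 1 + i = t + i + 1 by omega]
      exact hadj _ (by omega)
    · intro t ht
      exact hfL _ (by omega)
    · rwa [show k - i + i = k by omega]
  have h01 : G.Adj (f 0) (f 1) := hadj 0 hk
  have hreach : ∀ j, j + 1 ≤ k →
      ReachIn G {x | x = a ∨ (x ≠ f 0 ∧ ¬ G.Adj (f 0) x)} (f 1) (f (j + 1)) := by
    intro j
    induction j with
    | zero => exact fun _ => .refl
    | succ j ihj =>
      intro hj
      exact (ihj (by omega)).tail ⟨hadj (j + 1) (by omega),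
        Or.inr ⟨hneq _ (by omega) hj, hshort _ (by omega) hj⟩⟩
  have hL' : L ⊆ {x | x = a ∨ (x ≠ f 0 ∧ ¬ G.Adj (f 0) x)} := by
    intro x hx
    by_cases hxa : x = a
    · exact Or.inl hxa
    · exact Or.inr ⟨fun h => hfL 0 (Nat.zero_le _) (h ▸ hx), fun h => hxa (huniq x hx h)⟩
  have hr := hreach (k - 1) (by omega)
  rw [Nat.sub_add_cancel hk] at hr
  -- The neighbours `f 1` and `a` of `f 0` are joined by the walk through `f 2, …, f k` to `b` and
  -- on inside `L` to `a`; apart from its ends it avoids `f 0` and all neighbours of `f 0`.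
  have hf1a : G.Adj (f 1) a :=
    hG.adj_of_reachIn h01 hfa (fun h => hfL 1 hk (h ▸ ha))
      ((hr.tail ⟨hfb, hL' hb⟩).trans ((hL.conn b hb a ha).mono hL'))
  refine hab (ih (k - 1) (by omega) (fun t => f (t + 1)) a b
      (fun t ht => hadj _ (by omega)) (fun t ht => hfL _ (by omega)) ha hb hf1a ?_)
  rwa [show k - 1 + 1 = k by omega]

/-- In a connected chordal graph, every component of the complement of a nonempty connected
`P₃`-closed set is attached at a single vertex. -/
theorem ConnClosed.exists_attachment (hG : IsChordal G) (hconn : G.Connected) {L : Set V}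
    (hL : ConnClosed G L) {y : V} (hy : y ∉ L) : ∃ u ∈ L, Disjoint (branch G u y) L := by
  have hconn' : ∀ a b : V, ReachIn G Set.univ a b := by
    intro a b
    obtain ⟨p⟩ := hconn a b
    induction p with
    | nil => exact .refl
    | cons h _ ih => exact .head ⟨h, trivial⟩ ih
  have hexit : ∀ (S : Set V) (z : V), z ∈ L → ReachIn G S y z →
      ∃ c u, ReachIn G Lᶜ y c ∧ u ∈ L ∧ u ∈ S ∧ G.Adj c u := by
    intro S z hz hyz
    have : z ∉ L ∧ ReachIn G Lᶜ y z ∨ ∃ c u, ReachIn G Lᶜ y c ∧ u ∈ L ∧ u ∈ S ∧ G.Adj c u := by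
      clear hz
      induction hyz with
      | refl => exact Or.inl ⟨hy, .refl⟩
      | @tail c d _ h ih =>
        rcases ih with ⟨hc, hr⟩ | h'
        · by_cases hd : d ∈ L
          · exact Or.inr ⟨c, d, hr, hd, h.2, h.1⟩
          · exact Or.inl ⟨hd, hr.tail ⟨h.1, hd⟩⟩
        · exact Or.inr h'
    exact this.resolve_left fun h => h.1 hz
  obtain ⟨z, hz⟩ := hL.nonempty
  obtain ⟨c, u, hc, hu, -, hcu⟩ := hexit Set.univ z hz (hconn' y z)
  -- A vertex of `L` in the branch would be reached from `y` without passing `u`, so that walk would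
  -- enter `L` at some `u' ≠ u`, from the same component of the complement.
  refine ⟨u, hu, Set.disjoint_left.2 fun v hv hvL => ?_⟩
  obtain ⟨c', u', hc', hu', huu', hcu'⟩ := hexit _ v hvL hv
  have hr : ReachIn G Lᶜ c' c := (hc'.symm hy).trans hc
  obtain ⟨k, f, h0, hk, hadj, hf⟩ := hr.exists_seq
  refine huu' (attachment_unique hG hL k f u' u hadj (fun i hi => ?_) hu' hu
    (h0 ▸ hcu') (hk ▸ hcu))
  rcases Nat.eq_zero_or_pos i with rfl | h
  · rw [h0]; exact hc'.mem hy
  · exact hf i h hi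

/-- Some walk of length one or two leads from `L` to `y`. -/
def Near (G : SimpleGraph V) (L : Set V) (y : V) : Prop :=
  ∃ u ∈ L, G.Adj u y ∨ ∃ v, G.Adj u v ∧ G.Adj v y

/-- The vertices of the hull reachable from `u` inside the hull form a closed set containing `L` and
`y`, hence are the whole hull. When `y` is two steps from `u`, the middle vertex has two neighbours
in the hull and so belongs to it. -/
theorem ConnClosed.hull_insert {L : Set V} (hL : ConnClosed G L) {y : V} (h : Near G L y) :
    ConnClosed G (hull G (insert y L)) := by
  have hsub := subset_hull G (insert y L)
  have hcl := p3Closed_hull G (insert y L)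
  generalize hH : hull G (insert y L) = H at *
  obtain ⟨u, hu, huy⟩ := h
  have huH : u ∈ H := hsub (Set.mem_insert_of_mem _ hu)
  have hK : H ⊆ {v | ReachIn G H u v ∧ v ∈ H} := by
    rw [← hH]
    refine hull_subset ?_ ?_
    · rw [hH, p3Closed_iff]
      rintro x a b hxa hxb ⟨ha, haH⟩ ⟨hb, hbH⟩ hab
      have hx := p3Closed_iff.1 hcl x a b hxa hxb haH hbH hab
      exact ⟨ha.tail ⟨hxa.symm, hx⟩, hx⟩
    · rw [hH]
      rintro v (rfl | hv)
      · have hyH := hsub (Set.mem_insert v L)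
        refine ⟨?_, hyH⟩
        by_cases huv : u = v
        · exact huv ▸ .refl
        rcases huy with h | ⟨w, huw, hwy⟩
        · exact .single ⟨h, hyH⟩
        · have hwH := p3Closed_iff.1 hcl w u v huw.symm hwy huH hyH huv
          exact .head ⟨huw, hwH⟩ (.single ⟨hwy, hyH⟩)
      · exact ⟨(hL.conn u hu v hv).mono fun x hx => hsub (Set.mem_insert_of_mem _ hx),
          hsub (Set.mem_insert_of_mem _ hv)⟩
  exact ⟨hcl, fun a ha b hb => ((hK ha).1.symm huH).trans (hK hb).1, u, huH⟩

/-- If `y` is farther away, no vertex is adjacent both to `y` and to `L`, so adding `y` yields a set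
that is already closed; in it `y` is isolated. -/
theorem near_of_connected_hull {L : Set V} (hL : ConnClosed G L) {y : V} (hy : y ∉ L)
    (h : (G.induce (hull G (insert y L))).Connected) : Near G L y := by
  by_contra hn
  have hcl : P3Closed G (insert y L) := by
    have hny : ∀ x b, G.Adj x y → G.Adj x b → b ∈ L → False :=
      fun x b hxy hxb hb => hn ⟨b, hb, Or.inr ⟨x, hxb.symm, hxy⟩⟩
    rw [p3Closed_iff]
    rintro x a b hxa hxb (rfl | ha) (rfl | hb) hab
    · exact absurd rfl hab
    · exact (hny _ _ hxa hxb hb).elim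
    · exact (hny _ _ hxb hxa ha).elim
    · exact Or.inr (p3Closed_iff.1 hL.closed _ _ _ hxa hxb ha hb hab)
  rw [hull_eq_self hcl] at h
  obtain ⟨z, hz⟩ := hL.nonempty
  have hr := preconnected_induce_iff.1 h.1 z (Or.inr hz) y (Or.inl rfl)
  have : y ∈ L := by
    refine ReachIn.mem (G := G) (S := L) (a := z) ?_ hz
    have : ∀ v, ReachIn G (insert y L) z v → ReachIn G L z v := by
      intro v hv
      induction hv with
      | refl => exact .refl
      | @tail c d _ h ih =>
        rcases h.2 with rfl | hd
        · exact (hn ⟨c, ih.mem hz, Or.inl h.1⟩).elim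
        · exact ih.tail ⟨h.1, hd⟩
    exact this y hr
  exact hy this

theorem connMove_iff {L L' : Set V} (hL : ConnClosed G L) : ConnMove G L L' ↔
    ∃ y, y ∉ L ∧ Near G L y ∧ L' = hull G (insert y L) := by
  constructor
  · rintro ⟨y, hy, hc, rfl⟩
    exact ⟨y, hy, near_of_connected_hull hL hy hc, rfl⟩
  · rintro ⟨y, hy, hn, rfl⟩
    have h := hL.hull_insert hn
    have := h.nonempty.to_subtype
    exact ⟨y, hy, ⟨preconnected_induce_iff.2 h.conn⟩, rfl⟩

theorem connMove_empty_iff {L' : Set V} : ConnMove G ∅ L' ↔ ∃ y, L' = {y} := by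
  have key : ∀ y : V, hull G (insert y ∅) = {y} := fun y => by
    rw [insert_empty_eq, hull_eq_self (p3Closed_singleton y)]
  constructor
  · rintro ⟨y, -, -, rfl⟩
    exact ⟨y, key y⟩
  · rintro ⟨y, rfl⟩
    refine ⟨y, Set.notMem_empty y, ?_, (key y).symm⟩
    rw [key y]
    exact ⟨preconnected_induce_iff.2 (ConnClosed.singleton y).conn⟩

/-- If the hull missed `z`, it would meet the component of `z` in `G - u` nowhere, for some `u` in
the hull. Since `G - u` is connected, this leaves only `u` in the hull, contrary to `x ≠ y`. -/
theorem hull_pair_eq_univ (hb : IsBiconnected G) (hG : IsChordal G) {x y : V} (hxy : x ≠ y)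
    (hd : G.dist x y ≤ 2) : hull G {x, y} = Set.univ := by
  have hnear : Near G {x} y := by
    refine ⟨x, rfl, ?_⟩
    obtain ⟨p, hp⟩ := hb.1.exists_walk_length_eq_dist x y
    rw [← hp] at hd
    match p with
    | .nil => exact absurd rfl hxy
    | .cons h .nil => exact Or.inl h
    | .cons h (.cons h' .nil) => exact Or.inr ⟨_, h, h'⟩
    | .cons _ (.cons _ (.cons _ _)) => simp at hd
  have hH := (ConnClosed.singleton x).hull_insert hnear
  have hsub := subset_hull G (insert y {x})
  rw [Set.pair_comm]
  refine Set.eq_univ_of_forall fun z => ?_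
  by_contra hz
  obtain ⟨u, hu, hdis⟩ := hH.exists_attachment hG hb.1 hz
  have hbr : ∀ v ∈ hull G (insert y {x}), v = u := by
    intro v hv
    by_contra hvu
    exact Set.disjoint_left.1 hdis (preconnected_induce_iff.1 (hb.2 u) z
      (fun h => hz (h ▸ hu)) v hvu) hv
  exact hxy ((hbr x (hsub (Or.inr rfl))).trans (hbr y (hsub (Or.inl rfl))).symm)

end Graph
end P3Game

namespace P3Game

/-! ### Branches at a vertex and the independence of moves in different branches -/

section Branch

variable {V : Type*} {G : SimpleGraph V}

theorem mem_branch_self (u w : V) : w ∈ branch G u w := .refl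

theorem notMem_branch {u w : V} (h : w ≠ u) : u ∉ branch G u w :=
  fun hu => ReachIn.mem (S := {u}ᶜ) hu h rfl

theorem branch_adj {u w v x : V} (hv : v ∈ branch G u w) (hvx : G.Adj v x) (hx : x ≠ u) :
    x ∈ branch G u w :=
  Relation.ReflTransGen.tail hv ⟨hvx, hx⟩

theorem branch_eq_of_mem {u w y : V} (hy : y ≠ u) (hw : w ∈ branch G u y) :
    branch G u w = branch G u y := by
  ext v
  exact ⟨fun h => Relation.ReflTransGen.trans hw h,
    fun h => Relation.ReflTransGen.trans (ReachIn.symm (S := {u}ᶜ) hw hy) h⟩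

/-- A vertex of the branch has no neighbour outside it except `u`, which gives closedness; a walk to
`u` from outside the branch cannot enter it before reaching `u`. -/
theorem ConnClosed.compl_branch (hconn : G.Connected) {u w : V} (h : w ≠ u) :
    ConnClosed G (branch G u w)ᶜ := by
  have hu : u ∈ (branch G u w)ᶜ := notMem_branch h
  have key : ∀ v, v ∈ (branch G u w)ᶜ → ReachIn G (branch G u w)ᶜ v u := by
    intro v
    obtain ⟨p⟩ := hconn v u
    have : ∀ v z (_ : G.Walk v z), z = u → v ∈ (branch G u w)ᶜ →
        ReachIn G (branch G u w)ᶜ v u := by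
      intro v z p
      induction p with
      | nil => rintro rfl _; exact .refl
      | @cons v x z hvx _ ih =>
        intro hz hv
        by_cases hvu : v = u
        · exact hvu ▸ .refl
        have hx : x ∈ (branch G u w)ᶜ := fun hx => hv (branch_adj hx hvx.symm hvu)
        exact .head ⟨hvx, hx⟩ (ih hz hx)
    exact this v u p rfl
  refine ⟨?_, fun a ha b hb => (key a ha).trans ((key b hb).symm hb), u, hu⟩
  rw [p3Closed_iff]
  intro x a b hxa hxb ha hb hab hx
  have : ∀ c, G.Adj x c → c ∈ (branch G u w)ᶜ → c = u := fun c hxc hc => by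
    by_contra hcu
    exact hc (branch_adj hx hxc hcu)
  exact hab ((this a hxa ha).trans (this b hxb hb).symm)

theorem exists_adj_mem_branch (hconn : G.Connected) {u y : V} (h : y ≠ u) :
    ∃ c ∈ branch G u y, G.Adj u c := by
  obtain ⟨p⟩ := hconn y u
  have : ∀ v z (_ : G.Walk v z), z = u → v ≠ u → ∃ c ∈ branch G u v, G.Adj u c := by
    intro v z p
    induction p with
    | nil => intro h h'; exact absurd h h'
    | @cons v x z hvx _ ih =>
      intro hz hv
      by_cases hxu : x = u
      · exact ⟨v, .refl, hxu ▸ hvx.symm⟩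
      · obtain ⟨c, hc, huc⟩ := ih hz hxu
        exact ⟨c, Relation.ReflTransGen.head ⟨hvx, hxu⟩ hc, huc⟩
  exact this y u p rfl h

theorem disjoint_branch_of_adj (hG : IsChordal G) (hconn : G.Connected) {L : Set V}
    (hL : ConnClosed G L) {u w : V} (huw : G.Adj u w) (hu : u ∈ L) (hw : w ∉ L) :
    Disjoint (branch G u w) L := by
  obtain ⟨u', hu', hdis⟩ := hL.exists_attachment hG hconn hw
  by_cases h : u = u'
  · exact h ▸ hdis
  · exact absurd hu (Set.disjoint_left.1 hdis (branch_adj (mem_branch_self _ _) huw.symm h))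

/-- The vertices of a branch have no neighbours in a disjoint set other than the root. -/
theorem eq_root_of_adj {L : Set V} {u w v t : V} (hdis : Disjoint (branch G u w) L)
    (hv : v ∈ branch G u w) (ht : t ∈ L) (htv : G.Adj t v) : t = u := by
  by_contra h
  exact Set.disjoint_left.1 hdis (branch_adj hv htv.symm h) ht

theorem near_iff_of_disjoint {L : Set V} {u w y : V} (hu : u ∈ L)
    (hdis : Disjoint (branch G u w) L) (hy : y ∈ branch G u w) :
    Near G L y ↔ Near G {u} y := by
  constructor
  · rintro ⟨t, ht, hty | ⟨v, htv, hvy⟩⟩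
    · obtain rfl := eq_root_of_adj hdis hy ht hty
      exact ⟨t, rfl, Or.inl hty⟩
    · by_cases hvu : v = u
      · exact ⟨u, rfl, Or.inl (hvu ▸ hvy)⟩
      · obtain rfl := eq_root_of_adj hdis (branch_adj hy hvy.symm hvu) ht htv
        exact ⟨t, rfl, Or.inr ⟨v, htv, hvy⟩⟩
  · rintro ⟨_, rfl, h⟩
    exact ⟨_, hu, h⟩

/-- The branch communicates with its complement only through `u`, which is labeled already. Hence
the closure inside the branch is the same as if everything outside were labeled, and nothing new
arises outside. This makes the game a disjoint sum. -/
theorem hull_insert_eq {L : Set V} (hL : ConnClosed G L) {u w y : V} (hu : u ∈ L)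
    (hdis : Disjoint (branch G u w) L) (hy : y ∈ branch G u w) :
    hull G (insert y L) = L ∪ hull G (insert y (branch G u w)ᶜ) ∩ branch G u w := by
  have hadj : ∀ x a, x ∈ branch G u w → G.Adj x a → a ∉ branch G u w → a = u := by
    intro x a hx hxa ha
    by_contra h
    exact ha (branch_adj hx hxa h)
  have hLD : L ⊆ (branch G u w)ᶜ := fun x hx hx' => Set.disjoint_left.1 hdis hx' hx
  have huD := hLD hu
  have hLH := subset_hull G (insert y L)
  have hDH := subset_hull G (insert y (branch G u w)ᶜ)
  apply Set.Subset.antisymm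
  · refine hull_subset ?_ ?_
    · rw [p3Closed_iff]
      intro x a b hxa hxb ha hb hab
      by_cases hx : x ∈ branch G u w
      · have hin : ∀ c, c ∈ L ∪ hull G (insert y (branch G u w)ᶜ) ∩ branch G u w →
            c ∈ hull G (insert y (branch G u w)ᶜ) := by
          rintro c (hc | hc)
          · exact hDH (Or.inr (hLD hc))
          · exact hc.1
        exact Or.inr ⟨p3Closed_iff.1 (p3Closed_hull G _) x a b hxa hxb (hin a ha) (hin b hb) hab,
          hx⟩
      · by_cases hxu : x = u
        · exact Or.inl (hxu ▸ hu)
        have hin : ∀ c, G.Adj x c →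
            c ∈ L ∪ hull G (insert y (branch G u w)ᶜ) ∩ branch G u w → c ∈ L := by
          rintro c hxc (hc | hc)
          · exact hc
          · exact absurd (hadj c x hc.2 hxc.symm hx) hxu
        exact Or.inl (p3Closed_iff.1 hL.closed x a b hxa hxb (hin a hxa ha) (hin b hxb hb) hab)
    · rintro v (rfl | hv)
      · exact Or.inr ⟨hDH (Or.inl rfl), hy⟩
      · exact Or.inl hv
  · have hsub : hull G (insert y (branch G u w)ᶜ) ⊆
        hull G (insert y L) ∪ (branch G u w)ᶜ := by
      refine hull_subset ?_ ?_
      · rw [p3Closed_iff]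
        intro x a b hxa hxb ha hb hab
        by_cases hx : x ∈ branch G u w
        · have hin : ∀ c, G.Adj x c → c ∈ hull G (insert y L) ∪ (branch G u w)ᶜ →
              c ∈ hull G (insert y L) := by
            rintro c hxc (hc | hc)
            · exact hc
            · exact hadj x c hx hxc hc ▸ hLH (Or.inr hu)
          exact Or.inl (p3Closed_iff.1 (p3Closed_hull G _) x a b hxa hxb (hin a hxa ha)
            (hin b hxb hb) hab)
        · exact Or.inr hx
      · rintro v (rfl | hv)
        · exact Or.inl (hLH (Or.inl rfl))
        · exact Or.inr hv
    rintro v (hv | ⟨hv, hvD⟩)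
    · exact hLH (Or.inr hv)
    · exact (hsub hv).resolve_right fun h => h hvD

end Branch

/-! ### Nim-sums and least excluded values -/

section Nim

instance : Std.Commutative (HXor.hXor : ℕ → ℕ → ℕ) := ⟨Nat.xor_comm⟩

instance : Std.Associative (HXor.hXor : ℕ → ℕ → ℕ) := ⟨Nat.xor_assoc⟩

/-- The nim-sum of a finite family. -/
def nimFold {ι : Type*} (s : Finset ι) (f : ι → ℕ) : ℕ :=
  s.fold (HXor.hXor : ℕ → ℕ → ℕ) 0 f

theorem nimFold_insert {ι : Type*} [DecidableEq ι] {s : Finset ι} {f : ι → ℕ} {i : ι}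
    (h : i ∉ s) : nimFold (insert i s) f = f i ^^^ nimFold s f :=
  Finset.fold_insert h

theorem nimFold_disjUnion {ι : Type*} {s t : Finset ι} {f : ι → ℕ} (h : Disjoint s t) :
    nimFold (s.disjUnion t h) f = nimFold s f ^^^ nimFold t f :=
  Finset.fold_disjUnion (op := (HXor.hXor : ℕ → ℕ → ℕ)) (b₁ := 0) (b₂ := 0) h

/-- The winning strategy in Nim: every number below the nim-sum is obtained by lowering one summand.
-/
theorem exists_lt_of_lt_fold_xor {ι : Type*} [DecidableEq ι] (s : Finset ι) (f : ι → ℕ) :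
    ∀ a, a < nimFold s f →
      ∃ i ∈ s, ∃ b < f i, a = b ^^^ nimFold (s.erase i) f := by
  induction s using Finset.induction_on with
  | empty => exact fun a h => absurd h (Nat.not_lt_zero a)
  | @insert i s hi ih =>
    intro a ha
    rw [nimFold_insert hi] at ha
    rcases Nat.lt_xor_cases ha with h | h
    · refine ⟨i, Finset.mem_insert_self i s, _, h, ?_⟩
      rw [Finset.erase_insert hi, Nat.xor_assoc, Nat.xor_self, Nat.xor_zero]
    · obtain ⟨j, hj, b, hb, hab⟩ := ih _ h
      refine ⟨j, Finset.mem_insert_of_mem hj, b, hb, ?_⟩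
      have hij : i ≠ j := fun h => hi (h ▸ hj)
      rw [Finset.erase_insert_of_ne hij, nimFold_insert (by simp [hi]),
        Nat.xor_left_comm, ← hab, Nat.xor_comm a, ← Nat.xor_assoc, Nat.xor_self, Nat.zero_xor]

open Classical in
/-- The number of `m < n` such that all numbers up to `m` lie in `O`: the least number outside
`O`, if that is at most `n`. -/
noncomputable def boundedMex (n : ℕ) (O : Set ℕ) : ℕ :=
  ((Finset.range n).filter fun m => ∀ m' < n, m' ≤ m → m' ∈ O).card

theorem boundedMex_le (n : ℕ) (O : Set ℕ) : boundedMex n O ≤ n := by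
  classical
  exact (Finset.card_filter_le _ _).trans (Finset.card_range n).le

theorem boundedMex_spec {n : ℕ} {O : Set ℕ} {m : ℕ} (hm : m < n) (hmO : m ∉ O) :
    boundedMex n O ∉ O ∧ ∀ k < boundedMex n O, k ∈ O := by
  classical
  have hex : ∃ m, m ∉ O := ⟨m, hmO⟩
  have : boundedMex n O = Nat.find hex := by
    have hle : Nat.find hex ≤ m := Nat.find_min' hex hmO
    rw [boundedMex, ← Finset.card_range (Nat.find hex)]
    congr 1
    ext k
    rw [Finset.mem_filter, Finset.mem_range, Finset.mem_range]
    constructor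
    · rintro ⟨-, h⟩
      by_contra hc
      exact Nat.find_spec hex (h _ (by omega) (by omega))
    · intro h
      exact ⟨by omega, fun k' _ hk' => by
        by_contra hc
        exact Nat.find_min hex (by omega) hc⟩
  rw [this]
  exact ⟨Nat.find_spec hex, fun k hk => by
    by_contra hc
    exact Nat.find_min hex hk hc⟩

end Nim

/-! ### Sprague–Grundy analysis of the game -/

section Grundy

variable {n : ℕ} {G : SimpleGraph (Fin n)}

/-- Each branch at `u` is represented by the least neighbour of `u` in it. -/
def IsRep (G : SimpleGraph (Fin n)) (u w : Fin n) : Prop :=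
  G.Adj u w ∧ ∀ v < w, G.Adj u v → v ∉ branch G u w

open Classical in
/-- The representatives of the branches that are attached to `S`. -/
noncomputable def cross (G : SimpleGraph (Fin n)) (S : Set (Fin n)) : Finset (Fin n × Fin n) :=
  Finset.univ.filter fun p => IsRep G p.1 p.2 ∧ p.1 ∈ S ∧ p.2 ∉ S

theorem mem_cross {S : Set (Fin n)} {p : Fin n × Fin n} :
    p ∈ cross G S ↔ IsRep G p.1 p.2 ∧ p.1 ∈ S ∧ p.2 ∉ S := by
  simp [cross]

/-- The nim-sum of the values of the branches that are attached to `S`. -/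
noncomputable def nimSum (G : SimpleGraph (Fin n)) (γ : Fin n → Fin n → ℕ) (S : Set (Fin n)) : ℕ :=
  nimFold (cross G S) fun p => γ p.1 p.2

/-- The values of the options of a branch. -/
def options (G : SimpleGraph (Fin n)) (γ : Fin n → Fin n → ℕ) (u w : Fin n) : Set ℕ :=
  {m | ∃ y, (y ∈ branch G u w ∧ Near G {u} y) ∧
    nimSum G γ (hull G (insert y (branch G u w)ᶜ)) = m}

/-- Approximations to the Grundy values of the branches. -/
noncomputable def grundyIter (G : SimpleGraph (Fin n)) : ℕ → Fin n → Fin n → ℕ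
  | 0 => fun _ _ => 0
  | k + 1 => fun u w => boundedMex n (options G (grundyIter G k) u w)

theorem grundyIter_le (k : ℕ) (u w : Fin n) : grundyIter G k u w ≤ n := by
  cases k with
  | zero => exact Nat.zero_le n
  | succ k => exact boundedMex_le _ _

theorem IsRep.eq_of_branch_eq {u w w' : Fin n} (h : IsRep G u w) (h' : IsRep G u w')
    (hw' : w' ∈ branch G u w) : w = w' := by
  have hb := branch_eq_of_mem h.1.ne' hw'
  rcases lt_trichotomy w w' with hlt | heq | hlt
  · exact absurd (hb ▸ mem_branch_self u w) (h'.2 w hlt h.1)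
  · exact heq
  · exact absurd hw' (h.2 w' hlt h'.1)

theorem exists_isRep (hconn : G.Connected) {u y : Fin n} (h : y ≠ u) :
    ∃ w, IsRep G u w ∧ w ∈ branch G u y := by
  obtain ⟨w, ⟨hw, huw⟩, hmin⟩ := wellFounded_lt.has_min {c | c ∈ branch G u y ∧ G.Adj u c}
    (exists_adj_mem_branch hconn h)
  refine ⟨w, ⟨huw, fun v hv huv hvw => hmin v ⟨?_, huv⟩ hv⟩, hw⟩
  rwa [← branch_eq_of_mem h hw]

/-- A move in one branch replaces its summand by the nim-sum of the branches that remain inside it.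
All other summands stay, because a branch attached to the new set has its representative either
inside the old branch or outside it, and only the former are affected. -/
theorem nimSum_hull_insert {L : Set (Fin n)} (hL : ConnClosed G L) (γ : Fin n → Fin n → ℕ)
    {u w y : Fin n} (huw : IsRep G u w) (hu : u ∈ L)
    (hdis : Disjoint (branch G u w) L) (hy : y ∈ branch G u w) :
    (u, w) ∈ cross G L ∧ nimSum G γ (hull G (insert y L)) =
      nimSum G γ (hull G (insert y (branch G u w)ᶜ)) ^^^
        nimFold ((cross G L).erase (u, w)) fun p => γ p.1 p.2 := by
  have hwD := mem_branch_self (G := G) u w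
  have hLD : L ⊆ (branch G u w)ᶜ := fun x hx hx' => Set.disjoint_left.1 hdis hx' hx
  refine ⟨mem_cross.2 ⟨huw, hu, fun h => hLD h hwD⟩, ?_⟩
  have hDH := subset_hull G (insert y (branch G u w)ᶜ)
  have hdisj : Disjoint (cross G (hull G (insert y (branch G u w)ᶜ)))
      ((cross G L).erase (u, w)) := by
    rw [Finset.disjoint_left]
    rintro ⟨a, b⟩ h1 h2
    rw [Finset.mem_erase, mem_cross] at h2
    rw [mem_cross] at h1
    have hb : b ∈ branch G u w := by
      by_contra hb
      exact h1.2.2 (hDH (Or.inr hb))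
    obtain rfl := eq_root_of_adj hdis hb h2.2.2.1 h2.2.1.1
    exact h2.1 (by rw [huw.eq_of_branch_eq h2.2.1 hb])
  have hcross : cross G (hull G (insert y L)) =
      (cross G (hull G (insert y (branch G u w)ᶜ))).disjUnion ((cross G L).erase (u, w)) hdisj := by
    ext ⟨a, b⟩
    rw [Finset.mem_disjUnion, Finset.mem_erase, mem_cross, mem_cross, mem_cross,
      hull_insert_eq hL hu hdis hy]
    by_cases hab : IsRep G a b
    swap
    · simp [hab]
    simp only [hab, true_and]
    by_cases hb : b ∈ branch G u w
    · have h1 : a = u ∨ a ∈ branch G u w := by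
        by_cases h : a = u
        · exact Or.inl h
        · exact Or.inr (branch_adj hb hab.1.symm h)
      have h2 : b ∉ L := fun h => hLD h hb
      have h3 : ¬ ((a, b) ≠ (u, w) ∧ a ∈ L ∧ b ∉ L) := by
        rintro ⟨hne, ha, -⟩
        obtain rfl := eq_root_of_adj hdis hb ha hab.1
        exact hne (by rw [huw.eq_of_branch_eq hab hb])
      rw [or_iff_left h3]
      have h4 : a ∈ L ∪ hull G (insert y (branch G u w)ᶜ) ∩ branch G u w ↔
          a ∈ hull G (insert y (branch G u w)ᶜ) := by
        rcases h1 with rfl | h1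
        · exact iff_of_true (Or.inl hu) (hDH (Or.inr (hLD hu)))
        · exact ⟨fun h => h.elim (fun h => hDH (Or.inr (hLD h))) fun h => h.1,
            fun h => Or.inr ⟨h, h1⟩⟩
      rw [h4]
      simp [hb, h2]
    · have h1 : b ∈ hull G (insert y (branch G u w)ᶜ) := hDH (Or.inr hb)
      have h2 : (a, b) ≠ (u, w) := fun h => hb ((Prod.mk.inj h).2 ▸ hwD)
      have h3 : a ∈ branch G u w → b = u := fun ha => by
        by_contra h
        exact hb (branch_adj ha hab.1 h)
      simp only [h1, not_true, and_false, false_or, h2, ne_eq, not_false_eq_true, true_and,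
        Set.mem_union, Set.mem_inter_iff, hb, or_false]
      constructor
      · rintro ⟨ha | ha, hbL⟩
        · exact ⟨ha, hbL⟩
        · exact absurd (h3 ha.2 ▸ hu) hbL
      · rintro ⟨ha, hbL⟩
        exact ⟨Or.inl ha, hbL⟩
  rw [nimSum, nimSum, hcross, nimFold_disjUnion]

theorem ConnClosed.hull_insert_compl_branch (hconn : G.Connected) {u w y : Fin n} (h : w ≠ u)
    (hn : Near G {u} y) : ConnClosed G (hull G (insert y (branch G u w)ᶜ)) := by
  refine (ConnClosed.compl_branch hconn h).hull_insert ?_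
  obtain ⟨_, rfl, h'⟩ := hn
  exact ⟨_, notMem_branch h, h'⟩

/-- The branches left after the move lie inside the old one and miss `y`. -/
theorem ncard_branch_lt (hG : IsChordal G) (hconn : G.Connected) {u w y : Fin n} (h : w ≠ u)
    (hy : y ∈ branch G u w) (hn : Near G {u} y) {p : Fin n × Fin n}
    (hp : p ∈ cross G (hull G (insert y (branch G u w)ᶜ))) :
    (branch G p.1 p.2).ncard < (branch G u w).ncard := by
  rw [mem_cross] at hp
  have hdis := disjoint_branch_of_adj hG hconn
    (ConnClosed.hull_insert_compl_branch hconn h hn) hp.1.1 hp.2.1 hp.2.2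
  have hDH := subset_hull G (insert y (branch G u w)ᶜ)
  refine Set.ncard_lt_ncard ⟨fun v hv => ?_, fun hsub => ?_⟩
  · by_contra hvD
    exact Set.disjoint_left.1 hdis hv (hDH (Or.inr hvD))
  · exact Set.disjoint_left.1 hdis (hsub hy) (hDH (Or.inl rfl))

theorem nimSum_congr {γ γ' : Fin n → Fin n → ℕ} {S : Set (Fin n)}
    (h : ∀ p ∈ cross G S, γ p.1 p.2 = γ' p.1 p.2) : nimSum G γ S = nimSum G γ' S :=
  Finset.fold_congr h

theorem options_congr {γ γ' : Fin n → Fin n → ℕ} {u w : Fin n}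
    (h : ∀ y ∈ branch G u w, Near G {u} y →
      ∀ p ∈ cross G (hull G (insert y (branch G u w)ᶜ)), γ p.1 p.2 = γ' p.1 p.2) :
    options G γ u w = options G γ' u w := by
  ext m
  refine exists_congr fun y => and_congr_right fun hy => ?_
  rw [nimSum_congr (h y hy.1 hy.2)]

/-- The value of a branch with at most `k` vertices is final after `k` rounds, since its options
involve smaller branches only. -/
theorem grundyIter_stable (hG : IsChordal G) (hconn : G.Connected) (k : ℕ) :
    ∀ u w, w ≠ u → (branch G u w).ncard ≤ k → grundyIter G k u w = grundyIter G (k + 1) u w := by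
  induction k with
  | zero =>
    intro u w _ h
    rw [Nat.le_zero, Set.ncard_eq_zero] at h
    exact absurd (mem_branch_self (G := G) u w) (h ▸ Set.notMem_empty w)
  | succ k ih =>
    intro u w huw h
    change boundedMex n _ = boundedMex n _
    rw [options_congr]
    intro y hy hn p hp
    refine ih _ _ (mem_cross.1 hp).1.1.ne' ?_
    have := ncard_branch_lt hG hconn huw hy hn hp
    omega

theorem grundyIter_eq (hG : IsChordal G) (hconn : G.Connected) {u w : Fin n} (h : w ≠ u) :
    grundyIter G n u w = boundedMex n (options G (grundyIter G n) u w) := by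
  refine grundyIter_stable hG hconn n u w h ?_
  simpa using Set.ncard_le_card (branch G u w)

/-- An option is determined by a vertex other than `u`, so there are at most `n - 1` of them. Hence
the cut-off at `n` in `boundedMex` does no harm. -/
theorem exists_notMem_options (γ : Fin n → Fin n → ℕ) {u w : Fin n} (h : w ≠ u) :
    ∃ m < n, m ∉ options G γ u w := by
  by_contra! hc
  classical
  have hsub : Finset.range n ⊆ (Finset.univ.erase u).image
      fun y => nimSum G γ (hull G (insert y (branch G u w)ᶜ)) := by
    intro m hm
    obtain ⟨y, ⟨hy, -⟩, hm'⟩ := hc m (Finset.mem_range.1 hm)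
    refine Finset.mem_image.2 ⟨y, Finset.mem_erase.2 ⟨?_, Finset.mem_univ y⟩, hm'⟩
    rintro rfl
    exact notMem_branch h hy
  have h1 := (Finset.card_le_card hsub).trans Finset.card_image_le
  rw [Finset.card_range, Finset.card_erase_of_mem (Finset.mem_univ u), Finset.card_univ,
    Fintype.card_fin] at h1
  have := u.pos
  omega

theorem nimSum_move_ne (hG : IsChordal G) (hconn : G.Connected) {L L' : Set (Fin n)}
    (hL : ConnClosed G L) (h : ConnMove G L L') :
    nimSum G (grundyIter G n) L' ≠ nimSum G (grundyIter G n) L := by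
  obtain ⟨y, hy, hn, rfl⟩ := (connMove_iff hL).1 h
  obtain ⟨u, hu, hdis⟩ := hL.exists_attachment hG hconn hy
  have hyu : y ≠ u := fun h => hy (h ▸ hu)
  obtain ⟨w, huw, hw⟩ := exists_isRep hconn hyu
  have hb := branch_eq_of_mem hyu hw
  rw [← hb] at hdis
  have hyw : y ∈ branch G u w := hb ▸ mem_branch_self u y
  obtain ⟨hmem, heq⟩ := nimSum_hull_insert hL (grundyIter G n) huw hu hdis hyw
  rw [heq, nimSum, nimSum, ← Finset.insert_erase hmem, nimFold_insert (by simp),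
    Finset.erase_insert (by simp)]
  intro hx
  -- Cancelling the untouched summands, the value of the branch would be one of its own options.
  have hx' := Nat.xor_left_injective hx
  obtain ⟨m, hm, hmO⟩ := exists_notMem_options (G := G) (grundyIter G n) huw.1.ne'
  refine (boundedMex_spec hm hmO).1 ?_
  rw [← grundyIter_eq hG hconn huw.1.ne']
  exact ⟨y, ⟨hyw, (near_iff_of_disjoint hu hdis hyw).1 hn⟩, hx'⟩

theorem exists_move_nimSum_eq_zero (hG : IsChordal G) (hconn : G.Connected) {L : Set (Fin n)}
    (hL : ConnClosed G L) (h : nimSum G (grundyIter G n) L ≠ 0) :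
    ∃ L', ConnMove G L L' ∧ nimSum G (grundyIter G n) L' = 0 := by
  classical
  obtain ⟨⟨u, w⟩, hmem, b, hb, hb0⟩ := exists_lt_of_lt_fold_xor _ _ 0 (Nat.pos_of_ne_zero h)
  have hc := mem_cross.1 hmem
  have hdis := disjoint_branch_of_adj hG hconn hL hc.1.1 hc.2.1 hc.2.2
  dsimp only at hb hdis hc
  rw [grundyIter_eq hG hconn hc.1.1.ne'] at hb
  obtain ⟨m, hm, hmO⟩ := exists_notMem_options (G := G) (grundyIter G n) hc.1.1.ne'
  obtain ⟨y, ⟨hy, hn⟩, rfl⟩ := (boundedMex_spec hm hmO).2 b hb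
  refine ⟨_, (connMove_iff hL).2 ⟨y, fun hyL => Set.disjoint_left.1 hdis hy hyL,
    (near_iff_of_disjoint hc.2.1 hdis hy).2 hn, rfl⟩, ?_⟩
  rw [(nimSum_hull_insert hL _ hc.1 hc.2.1 hdis hy).2, hb0]

theorem moverWins_iff {V : Type*} {G : SimpleGraph V} {L : Set V} : MoverWins G L ↔
    ∃ L', ConnMove G L L' ∧ ∀ L'', ConnMove G L' L'' → MoverWins G L'' :=
  ⟨fun ⟨_, L', h, h'⟩ => ⟨L', h, h'⟩, fun ⟨L', h, h'⟩ => ⟨L, L', h, h'⟩⟩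

theorem ConnClosed.of_connMove {L L' : Set (Fin n)} (hL : ConnClosed G L)
    (h : ConnMove G L L') : ConnClosed G L' ∧ L'ᶜ.ncard < Lᶜ.ncard := by
  obtain ⟨y, hy, hn, rfl⟩ := (connMove_iff hL).1 h
  have hs := subset_hull G (insert y L)
  refine ⟨hL.hull_insert hn, Set.ncard_lt_ncard ⟨fun v hv hvL => hv (hs (Or.inr hvL)),
    fun hsub => hsub (a := y) hy (hs (Or.inl rfl))⟩⟩

/-- Induction on the number of unlabeled vertices, applied two moves ahead: a nonzero nim-sum can be
moved to zero, and every move from zero leads to a nonzero one. -/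
theorem moverWins_iff_nimSum_ne_zero (hG : IsChordal G) (hconn : G.Connected) (k : ℕ) :
    ∀ L : Set (Fin n), ConnClosed G L → Lᶜ.ncard ≤ k →
      (MoverWins G L ↔ nimSum G (grundyIter G n) L ≠ 0) := by
  induction k using Nat.strong_induction_on with
  | _ k ih =>
  intro L hL hk
  have ih' : ∀ L' L'', ConnMove G L L' → ConnMove G L' L'' →
      (MoverWins G L'' ↔ nimSum G (grundyIter G n) L'' ≠ 0) := by
    intro L' L'' h h'
    obtain ⟨h1, h2⟩ := hL.of_connMove h
    obtain ⟨h3, h4⟩ := h1.of_connMove h'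
    exact ih _ (by omega) L'' h3 le_rfl
  rw [moverWins_iff]
  constructor
  · rintro ⟨L', h, h'⟩
    have h0 : nimSum G (grundyIter G n) L' = 0 := by
      by_contra hne
      obtain ⟨L'', hm, h''⟩ := exists_move_nimSum_eq_zero hG hconn (hL.of_connMove h).1 hne
      exact (ih' L' L'' h hm).1 (h' L'' hm) h''
    exact fun h1 => nimSum_move_ne hG hconn hL h (h0.trans h1.symm)
  · intro hne
    obtain ⟨L', hm, h0⟩ := exists_move_nimSum_eq_zero hG hconn hL hne
    refine ⟨L', hm, fun L'' h' => (ih' L' L'' hm h').2 ?_⟩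
    rw [← h0]
    exact nimSum_move_ne hG hconn (hL.of_connMove hm).1 h'

/-- The empty position is not connected-closed and is treated apart: the first move reaches an
arbitrary `{x}`, which should be lost for the opponent. -/
theorem firstPlayerWins_iff (hG : IsChordal G) (hconn : G.Connected) :
    FirstPlayerWins G ↔ ∃ x, nimSum G (grundyIter G n) {x} = 0 := by
  rw [FirstPlayerWins, moverWins_iff]
  have key : ∀ L L' : Set (Fin n), ConnClosed G L → ConnMove G L L' →
      (MoverWins G L' ↔ nimSum G (grundyIter G n) L' ≠ 0) := fun L L' hL h =>
    moverWins_iff_nimSum_ne_zero hG hconn _ L' (hL.of_connMove h).1 le_rfl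
  constructor
  · rintro ⟨L', h, h'⟩
    obtain ⟨x, rfl⟩ := connMove_empty_iff.1 h
    refine ⟨x, ?_⟩
    by_contra hne
    obtain ⟨L'', hm, h''⟩ := exists_move_nimSum_eq_zero hG hconn (ConnClosed.singleton x) hne
    exact (key _ _ (ConnClosed.singleton x) hm).1 (h' L'' hm) h''
  · rintro ⟨x, hx⟩
    refine ⟨{x}, connMove_empty_iff.2 ⟨x, rfl⟩, fun L'' h' =>
      (key _ _ (ConnClosed.singleton x) h').2 ?_⟩
    rw [← hx]
    exact nimSum_move_ne hG hconn (ConnClosed.singleton x) h'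

end Grundy
end P3Game

namespace P3Game

/-! ### Running times of counting loops -/

section Machine

@[simp] theorem Store.setReg_reg (s : Store) (x v y : ℕ) :
    (s.setReg x v).reg y = if y = x then v else s.reg y := by
  simp [Store.setReg, Function.update_apply]

@[simp] theorem Store.setReg_arr (s : Store) (x v : ℕ) : (s.setReg x v).arr = s.arr := rfl

@[simp] theorem Store.setArr_reg (s : Store) (A i v : ℕ) : (s.setArr A i v).reg = s.reg := rfl

theorem Store.setArr_arr_self (s : Store) (A i v j : ℕ) :
    (s.setArr A i v).arr A j = if j = i then v else s.arr A j := by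
  simp [Store.setArr, Function.update_apply]

theorem Store.setArr_arr_of_ne (s : Store) {A B : ℕ} (i v : ℕ) (h : B ≠ A) :
    (s.setArr A i v).arr B = s.arr B := by
  simp [Store.setArr, h]

/-- Repeat `c` for the values `0, …, n - 1` of register `i`, where `n` is the value of
register `0`. -/
def Prog.forLoop (i : ℕ) (c : Prog) : Prog :=
  .seq (.assign i (.const 0)) (.loop (.sub (.var 0) (.var i))
    (.seq c (.assign i (.add (.var i) (.const 1)))))

/-- The body must preserve the counter and, through the invariant, register `0`. In each round the
test and the increment take four steps each, which the constant `9` covers. -/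
theorem runs_forLoop {i : ℕ} {c : Prog} {s : Store} {n T : ℕ} (Inv : ℕ → Store → Prop)
    (hn : ∀ k s, Inv k s → s.reg 0 = n) (h0 : Inv 0 (s.setReg i 0))
    (hstep : ∀ k < n, ∀ s, Inv k s → s.reg i = k → ∃ s' t, Runs c s s' t ∧ t ≤ T ∧
      s'.reg i = k ∧ Inv (k + 1) (s'.setReg i (k + 1))) :
    ∃ s' t, Runs (.forLoop i c) s s' t ∧ t ≤ n * (T + 9) + 9 ∧ Inv n s' := by
  have key : ∀ m k s, m + k = n → Inv k s → s.reg i = k →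
      ∃ s' t, Runs (.loop (.sub (.var 0) (.var i))
        (.seq c (.assign i (.add (.var i) (.const 1))))) s s' t ∧ t ≤ m * (T + 9) + 4 ∧
        Inv n s' := by
    intro m
    induction m with
    | zero =>
      intro k s hk hI hi
      obtain rfl : k = n := by omega
      exact ⟨s, _, .loopDone (by simp [Expr.eval, hn _ _ hI, hi]), by simp [Expr.cost], hI⟩
    | succ m ih =>
      intro k s hk hI hi
      obtain ⟨s', t, hr, ht, hi', hI'⟩ := hstep k (by omega) s hI hi
      obtain ⟨s'', t', hr', ht', hI''⟩ := ih (k + 1) (s'.setReg i (k + 1)) (by omega) hI' (by simp)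
      have hi'' : (Expr.add (.var i) (.const 1)).eval s' = k + 1 := by simp [Expr.eval, hi']
      rw [← hi''] at hr'
      refine ⟨s'', _, .loopStep (by simp [Expr.eval, hn _ _ hI, hi]; omega)
        (.seq hr (.assign i _ s')) hr', ?_, hI''⟩
      simp only [Expr.cost]
      rw [Nat.succ_mul]
      omega
  obtain ⟨s', t, hr, ht, hI⟩ := key n 0 (s.setReg i 0) rfl h0 (by simp)
  refine ⟨s', _, .seq (.assign i _ s) hr, ?_, hI⟩
  simp only [Expr.cost]
  omega

/-- Multiplication by `n` as repeated addition; it serves to compute the cell addresses `p * n + q`.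
-/
theorem runs_mulAdd {x y i n : ℕ} (hx : x ≠ 0) (hi : i ≠ 0) (hxy : x ≠ y) (hix : i ≠ x)
    (hiy : i ≠ y) {s : Store} (hn : s.reg 0 = n) :
    ∃ s' t, Runs (.forLoop i (.assign x (.add (.var x) (.var y)))) s s' t ∧ t ≤ n * 13 + 9 ∧
      (∀ z, z ≠ x → z ≠ i → s'.reg z = s.reg z) ∧ s'.arr = s.arr ∧
      s'.reg x = s.reg y * n + s.reg x := by
  obtain ⟨s', t, hr, ht, hI⟩ := runs_forLoop (i := i) (c := .assign x (.add (.var x) (.var y)))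
    (s := s) (n := n) (T := 4)
    (fun k s' => (∀ z, z ≠ x → z ≠ i → s'.reg z = s.reg z) ∧ s'.arr = s.arr ∧
      s'.reg x = s.reg y * k + s.reg x)
    (fun k s' h => by rw [h.1 0 hx.symm hi.symm, hn])
    ⟨fun z _ hzi => by simp [hzi], rfl, by simp [hix.symm]⟩
    (fun k hk s' ⟨h1, h2, h3⟩ hk' => by
      refine ⟨_, _, .assign x _ s', by simp [Expr.cost], by simp [hix, hk'], ?_, by simpa using h2, ?_⟩
      · intro z hz hz'
        simp [hz, hz', h1 z hz hz']
      · simp [hix.symm, Expr.eval, h3, h1 y hxy.symm hiy.symm, Nat.mul_succ]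
        omega)
  exact ⟨s', t, hr, ht, hI⟩

end Machine

/-! ### A language of bounded loops and its compilation -/

section Terms

/-- Terms of a functional language. The variables are numbered from the outside, variable `0`
being the size `n` of the input. `fold init body` starts with the value of `init` and replaces the
value, for `i = 0, …, n - 1`, by that of `body`, in which the first new variable is `i` and the
second one the current value. `table init step res` computes an `n × n` table, which is
initialized with `init` and recomputed `n` times with `step`, and then evaluates `res`; in `init`
and `step` the new variables are the number of the round, the row, and the column. -/
inductive Tm
  | const (k : ℕ)
  | var (x : ℕ)
  | get (A : ℕ) (p q : Tm)
  | add (e f : Tm)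
  | sub (e f : Tm)
  | ite (c e f : Tm)
  | fold (init body : Tm)
  | table (init step res : Tm)

/-- Start with `b` and apply `f 0`, `f 1`, … in turn. -/
def iter {α : Type*} (f : ℕ → α → α) (b : α) : ℕ → α
  | 0 => b
  | k + 1 => f k (iter f b k)

/-- Bind the variable `d`. -/
def bind (ρ : ℕ → ℕ) (d v : ℕ) : ℕ → ℕ := fun x => if x = d then v else ρ x

/-- Bind the table `b`. -/
def bindTable (τ : ℕ → ℕ → ℕ → ℕ) (b : ℕ) (T : ℕ → ℕ → ℕ) : ℕ → ℕ → ℕ → ℕ :=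
  fun A => if A = b then T else τ A

/-- The value of a term that has the variables below `d` and the tables below `b`. -/
def Tm.val (n : ℕ) : Tm → ℕ → ℕ → (ℕ → ℕ) → (ℕ → ℕ → ℕ → ℕ) → ℕ
  | .const k, _, _, _, _ => k
  | .var x, _, _, ρ, _ => ρ x
  | .get A p q, d, b, ρ, τ =>
    if p.val n d b ρ τ < n ∧ q.val n d b ρ τ < n then
      τ A (p.val n d b ρ τ) (q.val n d b ρ τ) else 0
  | .add e f, d, b, ρ, τ => e.val n d b ρ τ + f.val n d b ρ τ
  | .sub e f, d, b, ρ, τ => e.val n d b ρ τ - f.val n d b ρ τ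
  | .ite c e f, d, b, ρ, τ => if c.val n d b ρ τ ≠ 0 then e.val n d b ρ τ else f.val n d b ρ τ
  | .fold init body, d, b, ρ, τ =>
    iter (fun i acc => body.val n (d + 2) b (bind (bind ρ d i) (d + 1) acc) τ)
      (init.val n d b ρ τ) n
  | .table init step res, d, b, ρ, τ =>
    res.val n d (b + 2) ρ (bindTable τ b (iter (fun j T p q =>
      step.val n (d + 3) (b + 2) (bind (bind (bind ρ d j) (d + 1) p) (d + 2) q) (bindTable τ b T))
      (fun p q => init.val n (d + 3) (b + 2) (bind (bind (bind ρ d 0) (d + 1) p) (d + 2) q) τ) n))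

/-- The term uses only the variables below `d` and the tables in `R`. -/
def Tm.Wf : Tm → ℕ → ℕ → List ℕ → Prop
  | .const _, _, _, _ => True
  | .var x, d, _, _ => x < d
  | .get A p q, d, b, R => A ∈ R ∧ p.Wf d b R ∧ q.Wf d b R
  | .add e f, d, b, R => e.Wf d b R ∧ f.Wf d b R
  | .sub e f, d, b, R => e.Wf d b R ∧ f.Wf d b R
  | .ite c e f, d, b, R => c.Wf d b R ∧ e.Wf d b R ∧ f.Wf d b R
  | .fold init body, d, b, R => init.Wf d b R ∧ body.Wf (d + 2) b R
  | .table init step res, d, b, R =>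
    init.Wf (d + 3) (b + 2) R ∧ step.Wf (d + 3) (b + 2) (b :: R) ∧ res.Wf d (b + 2) (b :: R)

/-- Variable `x` is kept in register `2 * x`; the odd registers hold intermediate results. The
variables below `d`, the intermediate results below `t` and the arrays below `b` are preserved. -/
structure Frame (d t b : ℕ) (s s' : Store) : Prop where
  var : ∀ x < d, s'.reg (2 * x) = s.reg (2 * x)
  tmp : ∀ x < t, s'.reg (2 * x + 1) = s.reg (2 * x + 1)
  arr : ∀ A < b, s'.arr A = s.arr A

theorem Frame.refl (d t b : ℕ) (s : Store) : Frame d t b s s :=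
  ⟨fun _ _ => rfl, fun _ _ => rfl, fun _ _ => rfl⟩

theorem Frame.trans {d t b : ℕ} {s s' s'' : Store} (h : Frame d t b s s')
    (h' : Frame d t b s' s'') : Frame d t b s s'' :=
  ⟨fun x hx => (h'.var x hx).trans (h.var x hx), fun x hx => (h'.tmp x hx).trans (h.tmp x hx),
    fun x hx => (h'.arr x hx).trans (h.arr x hx)⟩

theorem Frame.mono {d t b d' t' b' : ℕ} {s s' : Store} (h : Frame d t b s s') (hd : d' ≤ d)
    (ht : t' ≤ t) (hb : b' ≤ b) : Frame d' t' b' s s' :=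
  ⟨fun x hx => h.var x (by omega), fun x hx => h.tmp x (by omega), fun x hx => h.arr x (by omega)⟩

theorem Frame.setTmp {d t b : ℕ} {s s' : Store} (h : Frame d t b s s') {x : ℕ} (hx : t ≤ x)
    (v : ℕ) : Frame d t b s (s'.setReg (2 * x + 1) v) :=
  ⟨fun y hy => by
    rw [Store.setReg_reg, if_neg (by omega), h.var y hy], fun y hy => by
    rw [Store.setReg_reg, if_neg (by omega), h.tmp y hy], h.arr⟩

theorem Frame.setVar {d t b : ℕ} {s s' : Store} (h : Frame d t b s s') {x : ℕ} (hx : d ≤ x)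
    (v : ℕ) : Frame d t b s (s'.setReg (2 * x) v) :=
  ⟨fun y hy => by
    rw [Store.setReg_reg, if_neg (by omega), h.var y hy], fun y hy => by
    rw [Store.setReg_reg, if_neg (by omega), h.tmp y hy], h.arr⟩

/-- The store `s` represents the variables below `d` and the tables in `R`. -/
structure Agree (n d : ℕ) (R : List ℕ) (ρ : ℕ → ℕ) (τ : ℕ → ℕ → ℕ → ℕ) (s : Store) : Prop where
  size : s.reg 0 = n
  var : ∀ x < d, s.reg (2 * x) = ρ x
  arr : ∀ A ∈ R, ∀ p < n, ∀ q < n, s.arr A (p * n + q) = τ A p q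

theorem Agree.frame {n d t b : ℕ} {R : List ℕ} {ρ : ℕ → ℕ} {τ : ℕ → ℕ → ℕ → ℕ} {s s' : Store}
    (h : Agree n d R ρ τ s) (hd : 0 < d) (hR : ∀ A ∈ R, A < b) (hf : Frame d t b s s') :
    Agree n d R ρ τ s' :=
  ⟨(hf.var 0 hd).trans h.size, fun x hx => (hf.var x hx).trans (h.var x hx),
    fun A hA p hp q hq => by rw [hf.arr A (hR A hA), h.arr A hA p hp q hq]⟩

theorem Agree.bindVar {n d : ℕ} {R : List ℕ} {ρ : ℕ → ℕ} {τ : ℕ → ℕ → ℕ → ℕ} {s : Store}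
    (h : Agree n d R ρ τ s) {v : ℕ} (hv : s.reg (2 * d) = v) :
    Agree n (d + 1) R (bind ρ d v) τ s := by
  refine ⟨h.size, fun x hx => ?_, h.arr⟩
  by_cases hxd : x = d
  · simp [bind, hxd, hv]
  · rw [h.var x (by omega), bind, if_neg hxd]

/-- The term can be evaluated in polynomial time, with the result in register `2 * t + 1`. -/
def Tm.Computable (e : Tm) (d b : ℕ) (R : List ℕ) : Prop :=
  ∀ t, ∃ (c : Prog) (P : Polynomial ℕ), ∀ n s ρ τ, Agree n d R ρ τ s →
    ∃ s' m, Runs c s s' m ∧ m ≤ P.eval n ∧ Frame d t b s s' ∧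
      s'.reg (2 * t + 1) = e.val n d b ρ τ

variable {d b : ℕ} {R : List ℕ}

theorem Tm.Computable.get {A : ℕ} {p q : Tm} (hd : 0 < d) (hR : ∀ A ∈ R, A < b) (hA : A ∈ R)
    (hp : p.Computable d b R) (hq : q.Computable d b R) : (Tm.get A p q).Computable d b R := by
  intro t
  obtain ⟨c, P, hc⟩ := hp t
  obtain ⟨c', P', hc'⟩ := hq (t + 1)
  refine ⟨.seq c (.seq c' (.ite (.sub (.var 0) (.var (2 * t + 1)))
    (.ite (.sub (.var 0) (.var (2 * (t + 1) + 1)))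
      (.seq (.forLoop (2 * (t + 2) + 1) (.assign (2 * (t + 1) + 1)
        (.add (.var (2 * (t + 1) + 1)) (.var (2 * t + 1)))))
        (.assign (2 * t + 1) (.get A (.var (2 * (t + 1) + 1)))))
      (.assign (2 * t + 1) (.const 0)))
    (.assign (2 * t + 1) (.const 0)))),
    P + P' + Polynomial.X * Polynomial.C 13 + Polynomial.C 30, ?_⟩
  intro n s ρ τ hs
  obtain ⟨s₁, m₁, hr₁, hm₁, hf₁, hv₁⟩ := hc n s ρ τ hs
  have hs₁ := hs.frame hd hR hf₁
  obtain ⟨s₂, m₂, hr₂, hm₂, hf₂, hv₂⟩ := hc' n s₁ ρ τ hs₁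
  have hs₂ := hs₁.frame hd hR hf₂
  have hv₁' := (hf₂.tmp t (by omega)).trans hv₁
  have hf := hf₁.trans (hf₂.mono le_rfl (Nat.le_succ t) le_rfl)
  simp only [Polynomial.eval_add, Polynomial.eval_mul, Polynomial.eval_X, Polynomial.eval_C]
  by_cases h1 : p.val n d b ρ τ < n
  swap
  · refine ⟨_, _, .seq hr₁ (.seq hr₂ (.iteFalse ?_ (.assign _ _ _))), ?_, hf.setTmp le_rfl _, ?_⟩
    · simp [Expr.eval, hs₂.size, hv₁']; omega
    · simp only [Expr.cost]; omega
    · simp [Expr.eval, Tm.val, h1]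
  by_cases h2 : q.val n d b ρ τ < n
  swap
  · refine ⟨_, _, .seq hr₁ (.seq hr₂ (.iteTrue ?_ (.iteFalse ?_ (.assign _ _ _)))), ?_,
      hf.setTmp le_rfl _, ?_⟩
    · simp [Expr.eval, hs₂.size, hv₁']; omega
    · simp [Expr.eval, hs₂.size, hv₂]; omega
    · simp only [Expr.cost]; omega
    · simp [Expr.eval, Tm.val, h2]
  obtain ⟨s₃, m₃, hr₃, hm₃, hf₃, ha₃, hv₃⟩ := runs_mulAdd (x := 2 * (t + 1) + 1) (y := 2 * t + 1)
    (i := 2 * (t + 2) + 1) (by omega) (by omega) (by omega) (by omega) (by omega) hs₂.size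
  have hf' : Frame d t b s s₃ := hf.trans ⟨fun x _ => hf₃ _ (by omega) (by omega),
    fun x _ => hf₃ _ (by omega) (by omega), fun A _ => by rw [ha₃]⟩
  refine ⟨_, _, .seq hr₁ (.seq hr₂ (.iteTrue ?_ (.iteTrue ?_ (.seq hr₃ (.assign _ _ _))))), ?_,
      hf'.setTmp le_rfl _, ?_⟩
  · simp [Expr.eval, hs₂.size, hv₁']; omega
  · simp [Expr.eval, hs₂.size, hv₂]; omega
  · simp only [Expr.cost]; omega
  · simp only [Store.setReg_reg, if_true, Expr.eval, Tm.val, h1, h2, and_self, hv₃, hv₁', hv₂, ha₃]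
    exact hs₂.arr A hA _ h1 _ h2

theorem Tm.Computable.add {e f : Tm} (hd : 0 < d) (hR : ∀ A ∈ R, A < b)
    (he : e.Computable d b R) (hf : f.Computable d b R) : (Tm.add e f).Computable d b R := by
  intro t
  obtain ⟨c, P, hc⟩ := he t
  obtain ⟨c', P', hc'⟩ := hf (t + 1)
  refine ⟨.seq c (.seq c' (.assign (2 * t + 1)
    (.add (.var (2 * t + 1)) (.var (2 * (t + 1) + 1))))), P + P' + Polynomial.C 4, ?_⟩
  intro n s ρ τ hs
  obtain ⟨s₁, m₁, hr₁, hm₁, hf₁, hv₁⟩ := hc n s ρ τ hs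
  obtain ⟨s₂, m₂, hr₂, hm₂, hf₂, hv₂⟩ := hc' n s₁ ρ τ (hs.frame hd hR hf₁)
  refine ⟨_, _, .seq hr₁ (.seq hr₂ (.assign _ _ _)), ?_,
    (hf₁.trans (hf₂.mono le_rfl (Nat.le_succ t) le_rfl)).setTmp le_rfl _, ?_⟩
  · simp only [Polynomial.eval_add, Polynomial.eval_C, Expr.cost]; omega
  · simp [Expr.eval, Tm.val, hv₂, hf₂.tmp t (by omega), hv₁]

theorem Tm.Computable.sub {e f : Tm} (hd : 0 < d) (hR : ∀ A ∈ R, A < b)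
    (he : e.Computable d b R) (hf : f.Computable d b R) : (Tm.sub e f).Computable d b R := by
  intro t
  obtain ⟨c, P, hc⟩ := he t
  obtain ⟨c', P', hc'⟩ := hf (t + 1)
  refine ⟨.seq c (.seq c' (.assign (2 * t + 1)
    (.sub (.var (2 * t + 1)) (.var (2 * (t + 1) + 1))))), P + P' + Polynomial.C 4, ?_⟩
  intro n s ρ τ hs
  obtain ⟨s₁, m₁, hr₁, hm₁, hf₁, hv₁⟩ := hc n s ρ τ hs
  obtain ⟨s₂, m₂, hr₂, hm₂, hf₂, hv₂⟩ := hc' n s₁ ρ τ (hs.frame hd hR hf₁)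
  refine ⟨_, _, .seq hr₁ (.seq hr₂ (.assign _ _ _)), ?_,
    (hf₁.trans (hf₂.mono le_rfl (Nat.le_succ t) le_rfl)).setTmp le_rfl _, ?_⟩
  · simp only [Polynomial.eval_add, Polynomial.eval_C, Expr.cost]; omega
  · simp [Expr.eval, Tm.val, hv₂, hf₂.tmp t (by omega), hv₁]

theorem Tm.Computable.ite {c e f : Tm} (hd : 0 < d) (hR : ∀ A ∈ R, A < b)
    (hc : c.Computable d b R) (he : e.Computable d b R) (hf : f.Computable d b R) :
    (Tm.ite c e f).Computable d b R := by
  intro t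
  obtain ⟨c₀, P₀, hc₀⟩ := hc t
  obtain ⟨c₁, P₁, hc₁⟩ := he t
  obtain ⟨c₂, P₂, hc₂⟩ := hf t
  refine ⟨.seq c₀ (.ite (.var (2 * t + 1)) c₁ c₂), P₀ + P₁ + P₂ + Polynomial.C 2, ?_⟩
  intro n s ρ τ hs
  obtain ⟨s₁, m₁, hr₁, hm₁, hf₁, hv₁⟩ := hc₀ n s ρ τ hs
  simp only [Polynomial.eval_add, Polynomial.eval_C, Tm.val]
  by_cases h : c.val n d b ρ τ = 0
  · obtain ⟨s₂, m₂, hr₂, hm₂, hf₂, hv₂⟩ := hc₂ n s₁ ρ τ (hs.frame hd hR hf₁)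
    refine ⟨s₂, _, .seq hr₁ (.iteFalse (by simp [Expr.eval, hv₁, h]) hr₂), ?_, hf₁.trans hf₂, ?_⟩
    · simp only [Expr.cost]; omega
    · rw [hv₂, if_neg (not_not.2 h)]
  · obtain ⟨s₂, m₂, hr₂, hm₂, hf₂, hv₂⟩ := hc₁ n s₁ ρ τ (hs.frame hd hR hf₁)
    refine ⟨s₂, _, .seq hr₁ (.iteTrue (by simp [Expr.eval, hv₁, h]) hr₂), ?_, hf₁.trans hf₂, ?_⟩
    · simp only [Expr.cost]; omega
    · rw [hv₂, if_pos h]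

theorem Tm.Computable.fold {init body : Tm} (hd : 0 < d) (hR : ∀ A ∈ R, A < b)
    (hi : init.Computable d b R) (hb : body.Computable (d + 2) b R) :
    (Tm.fold init body).Computable d b R := by
  intro t
  obtain ⟨c₀, P₀, hc₀⟩ := hi t
  obtain ⟨c₁, P₁, hc₁⟩ := hb t
  refine ⟨.seq c₀ (.seq (.assign (2 * (d + 1)) (.var (2 * t + 1)))
    (.seq (.forLoop (2 * d) (.seq c₁ (.assign (2 * (d + 1)) (.var (2 * t + 1)))))
      (.assign (2 * t + 1) (.var (2 * (d + 1)))))),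
    P₀ + Polynomial.X * (P₁ + Polynomial.C 11) + Polynomial.C 15, ?_⟩
  intro n s ρ τ hs
  obtain ⟨s₁, m₁, hr₁, hm₁, hf₁, hv₁⟩ := hc₀ n s ρ τ hs
  let g : ℕ → ℕ → ℕ := fun i acc =>
    body.val n (d + 2) b (bind (bind ρ d i) (d + 1) acc) τ
  obtain ⟨s₂, m₂, hr₂, hm₂, hf₂, hv₂⟩ := runs_forLoop (i := 2 * d)
    (c := .seq c₁ (.assign (2 * (d + 1)) (.var (2 * t + 1))))
    (s := s₁.setReg (2 * (d + 1)) (s₁.reg (2 * t + 1))) (n := n) (T := P₁.eval n + 2)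
    (fun k s' => Frame d t b s s' ∧ s'.reg (2 * (d + 1)) = iter g (init.val n d b ρ τ) k)
    (fun k s' h => (h.1.var 0 hd).trans hs.size)
    ⟨(hf₁.setVar (Nat.le_succ d) _).setVar le_rfl _, by simp [iter, hv₁]⟩
    (fun k hk s' ⟨h1, h2⟩ hk' => by
      obtain ⟨s'', m, hr, hm, hf, hv⟩ := hc₁ n s' (bind (bind ρ d k) (d + 1) _) τ
        (((hs.frame hd hR h1).bindVar hk').bindVar h2)
      refine ⟨_, _, .seq hr (.assign _ _ _), ?_, ?_, ?_, ?_⟩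
      · simp only [Expr.cost]; omega
      · simp [hf.var d (by omega), hk']
      · exact ((h1.trans (hf.mono (by omega) le_rfl le_rfl)).setVar (Nat.le_succ d) _).setVar
          le_rfl _
      · simp [Expr.eval, hv, iter, g])
  refine ⟨_, _, .seq hr₁ (.seq (.assign _ _ _) (.seq hr₂ (.assign _ _ _))), ?_,
    hf₂.setTmp le_rfl _, ?_⟩
  · simp only [Polynomial.eval_add, Polynomial.eval_mul, Polynomial.eval_X, Polynomial.eval_C,
      Expr.cost]
    have : n * (P₁.eval n + 2 + 9) = n * (P₁.eval n + 11) := rfl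
    omega
  · simp [Expr.eval, hv₂, Tm.val, g]

theorem add_mul_inj {n p q p' q' : ℕ} (hq : q < n) (hq' : q' < n)
    (h : p * n + q = p' * n + q') : p = p' ∧ q = q' := by
  have h1 : (p * n + q) / n = p := by
    rw [Nat.add_comm, Nat.add_mul_div_right _ _ (by omega), Nat.div_eq_of_lt hq, Nat.zero_add]
  have h2 : (p' * n + q') / n = p' := by
    rw [Nat.add_comm, Nat.add_mul_div_right _ _ (by omega), Nat.div_eq_of_lt hq', Nat.zero_add]
  have h3 : p = p' := by rw [← h1, h, h2]
  subst h3
  exact ⟨rfl, by omega⟩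

/-- A table can be filled with the values of a term. -/
theorem Tm.Computable.tabulate {e : Tm} {A : ℕ} (hR : ∀ A ∈ R, A < b) (hA : A < b) (hAR : A ∉ R)
    (he : e.Computable (d + 3) b R) (t : ℕ) : ∃ (c : Prog) (P : Polynomial ℕ), ∀ n s ρ τ,
      Agree n (d + 1) R ρ τ s → ∃ s' m, Runs c s s' m ∧ m ≤ P.eval n ∧
        Frame (d + 1) t 0 s s' ∧ (∀ A' < b, A' ≠ A → s'.arr A' = s.arr A') ∧
        ∀ p < n, ∀ q < n, s'.arr A (p * n + q) =
          e.val n (d + 3) b (bind (bind ρ (d + 1) p) (d + 2) q) τ := by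
  obtain ⟨c, P, hc⟩ := he t
  refine ⟨.forLoop (2 * (d + 1)) (.forLoop (2 * (d + 2)) (.seq c (.seq
    (.assign (2 * (t + 1) + 1) (.var (2 * (d + 2)))) (.seq
    (.forLoop (2 * (t + 2) + 1) (.assign (2 * (t + 1) + 1)
      (.add (.var (2 * (t + 1) + 1)) (.var (2 * (d + 1))))))
    (.put A (.var (2 * (t + 1) + 1)) (.var (2 * t + 1))))))),
    Polynomial.X * (Polynomial.X * (P + Polynomial.X * Polynomial.C 13 + Polynomial.C 23) +
      Polynomial.C 18) + Polynomial.C 9, ?_⟩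
  intro n s ρ τ hs
  let F : ℕ → ℕ → ℕ := fun p q => e.val n (d + 3) b (bind (bind ρ (d + 1) p) (d + 2) q) τ
  -- The array `A` is overwritten while `e` is still being evaluated; this is harmless because `A ∉
  -- R`, so that `e` does not read it.
  have hagree : ∀ s', Frame (d + 1) t 0 s s' → (∀ A' < b, A' ≠ A → s'.arr A' = s.arr A') →
      Agree n (d + 1) R ρ τ s' := fun s' h h' =>
    ⟨(h.var 0 (by omega)).trans hs.size, fun x hx => (h.var x hx).trans (hs.var x hx),
      fun A' hA' p hp q hq => by
        rw [h' A' (hR A' hA') (fun h => hAR (h ▸ hA')), hs.arr A' hA' p hp q hq]⟩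
  have hinner : ∀ p < n, ∀ s', s'.reg (2 * (d + 1)) = p →
      (Frame (d + 1) t 0 s s' ∧ (∀ A' < b, A' ≠ A → s'.arr A' = s.arr A') ∧
        ∀ p' < p, ∀ q < n, s'.arr A (p' * n + q) = F p' q) →
      ∃ s'' m, Runs (.forLoop (2 * (d + 2)) (.seq c (.seq
        (.assign (2 * (t + 1) + 1) (.var (2 * (d + 2)))) (.seq
        (.forLoop (2 * (t + 2) + 1) (.assign (2 * (t + 1) + 1)
          (.add (.var (2 * (t + 1) + 1)) (.var (2 * (d + 1))))))
        (.put A (.var (2 * (t + 1) + 1)) (.var (2 * t + 1))))))) s' s'' m ∧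
        m ≤ n * (P.eval n + n * 13 + 14 + 9) + 9 ∧ (s''.reg (2 * (d + 1)) = p ∧
        Frame (d + 1) t 0 s s'' ∧ (∀ A' < b, A' ≠ A → s''.arr A' = s.arr A') ∧
        (∀ p' < p, ∀ q < n, s''.arr A (p' * n + q) = F p' q) ∧
        ∀ q < n, s''.arr A (p * n + q) = F p q) := by
    rintro p hp s' hsp ⟨h1, h2, h3⟩
    refine runs_forLoop (fun k s'' => s''.reg (2 * (d + 1)) = p ∧
        Frame (d + 1) t 0 s s'' ∧ (∀ A' < b, A' ≠ A → s''.arr A' = s.arr A') ∧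
        (∀ p' < p, ∀ q < n, s''.arr A (p' * n + q) = F p' q) ∧
        ∀ q < k, s''.arr A (p * n + q) = F p q)
      (fun k s'' h => (h.2.1.var 0 (by omega)).trans hs.size)
      ⟨by simp [hsp], h1.setVar (by omega) _, h2, h3, by simp⟩ ?_
    rintro k hk s₀ ⟨g0, g1, g2, g3, g4⟩ hsk
    obtain ⟨s₁, m₁, hr₁, hm₁, hf₁, hv₁⟩ := hc n s₀ (bind (bind ρ (d + 1) p) (d + 2) k) τ
      (((hagree s₀ g1 g2).bindVar g0).bindVar hsk)
    have hn₁ : (s₁.setReg (2 * (t + 1) + 1) (s₁.reg (2 * (d + 2)))).reg 0 = n := by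
      have := hf₁.var 0 (by omega)
      rw [Nat.mul_zero] at this
      simp [this, (hagree s₀ g1 g2).size]
    obtain ⟨s₂, m₂, hr₂, hm₂, hf₂, ha₂, hv₂⟩ := runs_mulAdd (x := 2 * (t + 1) + 1)
      (y := 2 * (d + 1)) (i := 2 * (t + 2) + 1) (by omega) (by omega) (by omega) (by omega)
      (by omega) hn₁
    have haddr : s₂.reg (2 * (t + 1) + 1) = p * n + k := by
      have h' : 2 * (d + 1) ≠ 2 * (t + 1) + 1 := by omega
      rw [hv₂, Store.setReg_reg, Store.setReg_reg, if_neg h', if_pos rfl,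
        hf₁.var (d + 1) (by omega), hf₁.var (d + 2) (by omega), g0, hsk]
    have hval : s₂.reg (2 * t + 1) = F p k := by
      rw [hf₂ _ (by omega) (by omega), Store.setReg_reg, if_neg (by omega), hv₁]
    have harr : s₂.arr = s₁.arr := ha₂
    have hreg : ∀ x < d + 3, s₂.reg (2 * x) = s₀.reg (2 * x) := fun x hx => by
      rw [hf₂ _ (by omega) (by omega), Store.setReg_reg, if_neg (by omega), hf₁.var x hx]
    have htmp : ∀ x < t, s₂.reg (2 * x + 1) = s₀.reg (2 * x + 1) := fun x hx => by
      rw [hf₂ _ (by omega) (by omega), Store.setReg_reg, if_neg (by omega), hf₁.tmp x hx]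
    refine ⟨_, _, .seq hr₁ (.seq (.assign _ _ _) (.seq hr₂ (.put _ _ _ _))), ?_, ?_, ?_, ?_, ?_, ?_⟩
    · simp only [Expr.cost]; omega
    · rw [Store.setArr_reg, hreg (d + 2) (by omega), hsk]
    · rw [Store.setReg_reg, if_neg (by omega), Store.setArr_reg, hreg (d + 1) (by omega), g0]
    · refine Frame.setVar (x := d + 2)
        (g1.trans ⟨fun x hx => ?_, fun x hx => ?_, fun _ h => absurd h (Nat.not_lt_zero _)⟩)
        (by omega) _
      · exact hreg x (by omega)
      · exact htmp x hx
    · intro A' hA' hne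
      rw [Store.setReg_arr, Store.setArr_arr_of_ne _ _ _ hne, harr, hf₁.arr A' hA', g2 A' hA' hne]
    · have hput : ∀ p' q, q < n → (Store.setReg (s₂.setArr A (Expr.eval s₂ (.var (2 * (t + 1) + 1)))
          (Expr.eval s₂ (.var (2 * t + 1)))) (2 * (d + 2)) (k + 1)).arr A (p' * n + q) =
          if p' = p ∧ q = k then F p k else s₀.arr A (p' * n + q) := by
        intro p' q hq
        rw [Store.setReg_arr, Store.setArr_arr_self, harr, hf₁.arr A hA]
        simp only [Expr.eval, haddr, hval]
        refine if_congr ⟨fun h => add_mul_inj hq hk h, ?_⟩ rfl rfl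
        rintro ⟨rfl, rfl⟩
        rfl
      refine ⟨fun p' hp' q hq => ?_, fun q hq => ?_⟩
      · rw [hput p' q hq, if_neg (by omega), g3 p' hp' q hq]
      · rw [hput p q (by omega)]
        by_cases hqk : q = k
        · rw [if_pos ⟨rfl, hqk⟩, hqk]
        · rw [if_neg (fun h => hqk h.2), g4 q (by omega)]
  obtain ⟨s', m, hr, hm, h1, h2, h3⟩ := runs_forLoop (i := 2 * (d + 1)) (s := s) (n := n)
    (fun k s' => Frame (d + 1) t 0 s s' ∧
      (∀ A' < b, A' ≠ A → s'.arr A' = s.arr A') ∧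
      ∀ p < k, ∀ q < n, s'.arr A (p * n + q) = F p q)
    (fun k s' h => (h.1.var 0 (by omega)).trans hs.size)
    ⟨(Frame.refl _ _ _ _).setVar le_rfl _, fun _ _ _ => rfl, by simp⟩
    (fun p hp s' h hsp => by
      obtain ⟨s'', m, hr, hm, h0, h1, h2, h3, h4⟩ := hinner p hp s' hsp h
      refine ⟨s'', m, hr, hm, h0, h1.setVar le_rfl _, h2, fun p' hp' q hq => ?_⟩
      rcases Nat.lt_succ_iff_lt_or_eq.1 hp' with h | rfl
      · exact h3 p' h q hq
      · exact h4 q hq)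
  refine ⟨s', m, hr, ?_, h1, h2, h3⟩
  simpa [Nat.add_assoc] using hm

theorem Tm.Computable.var {x : ℕ} (h : x < d) : (Tm.var x).Computable d b R := by
  intro t
  refine ⟨.assign (2 * t + 1) (.var (2 * x)), Polynomial.C 2, fun n s ρ τ hs => ?_⟩
  exact ⟨_, _, .assign _ _ _, by simp [Expr.cost], (Frame.refl _ _ _ _).setTmp le_rfl _,
    by simp [Expr.eval, Tm.val, hs.var x h]⟩

theorem Tm.Computable.const (k : ℕ) : (Tm.const k).Computable d b R := by
  intro t
  refine ⟨.assign (2 * t + 1) (.const k), Polynomial.C 2, fun n s ρ τ hs => ?_⟩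
  exact ⟨_, _, .assign _ _ _, by simp [Expr.cost], (Frame.refl _ _ _ _).setTmp le_rfl _,
    by simp [Expr.eval, Tm.val]⟩

theorem Tm.Computable.table {init step res : Tm} (hd : 0 < d) (hR : ∀ A ∈ R, A < b)
    (hi : init.Computable (d + 3) (b + 2) R) (hs : step.Computable (d + 3) (b + 2) (b :: R))
    (hr : res.Computable d (b + 2) (b :: R)) : (Tm.table init step res).Computable d b R := by
  intro t
  have hR' : ∀ A ∈ R, A < b + 2 := fun A hA => (hR A hA).trans (by omega)
  have hbR : ∀ A ∈ b :: R, A < b + 2 := by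
    intro A hA
    rcases List.mem_cons.1 hA with rfl | hA
    · omega
    · exact hR' A hA
  -- A round builds the new table in array `b + 1`, because `step` still reads the old one in array
  -- `b`. This term serves to copy it back, and explains why a table takes up two array numbers.
  have hcopy : (Tm.get (b + 1) (.var (d + 1)) (.var (d + 2))).Computable (d + 3) (b + 2) [b + 1] :=
    .get (by omega) (by simp) (by simp) (.var (by omega)) (.var (by omega))
  obtain ⟨c₀, P₀, hc₀⟩ := hi.tabulate (A := b) hR' (by omega) (fun h => (hR b h).false) t
  obtain ⟨c₁, P₁, hc₁⟩ := hs.tabulate (A := b + 1) hbR (by omega)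
    (fun h => by
      rcases List.mem_cons.1 h with h | h
      · omega
      · have := hR _ h; omega) t
  obtain ⟨c₂, P₂, hc₂⟩ := hcopy.tabulate (A := b) (by simp) (by omega) (by simp) t
  obtain ⟨c₃, P₃, hc₃⟩ := hr t
  refine ⟨.seq (.assign (2 * d) (.const 0)) (.seq c₀ (.seq (.forLoop (2 * d) (.seq c₁ c₂)) c₃)),
    P₀ + Polynomial.X * (P₁ + P₂ + Polynomial.C 9) + P₃ + Polynomial.C 11, ?_⟩
  intro n s ρ τ hs
  have hs' : Agree n (d + 1) R (bind ρ d 0) τ (s.setReg (2 * d) 0) :=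
    (hs.frame hd hR ((Frame.refl d t b s).setVar le_rfl 0)).bindVar (by simp)
  obtain ⟨s₀, m₀, hr₀, hm₀, hf₀, ha₀, hv₀⟩ := hc₀ n _ _ _ hs'
  let g : ℕ → (ℕ → ℕ → ℕ) → ℕ → ℕ → ℕ := fun j T p q =>
      step.val n (d + 3) (b + 2) (bind (bind (bind ρ d j) (d + 1) p) (d + 2) q) (bindTable τ b T)
  let T₀ : ℕ → ℕ → ℕ := fun p q =>
    init.val n (d + 3) (b + 2) (bind (bind (bind ρ d 0) (d + 1) p) (d + 2) q) τ
  have hagree : ∀ (T : ℕ → ℕ → ℕ) s', Frame d t b s s' →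
      (∀ p < n, ∀ q < n, s'.arr b (p * n + q) = T p q) →
      Agree n d (b :: R) ρ (bindTable τ b T) s' := by
    intro T s' hf h
    have := hs.frame hd hR hf
    refine ⟨this.size, this.var, fun A hA p hp q hq => ?_⟩
    by_cases hAb : A = b
    · subst hAb
      rw [h p hp q hq, bindTable, if_pos rfl]
    · rw [this.arr A ((List.mem_cons.1 hA).resolve_left hAb) p hp q hq, bindTable, if_neg hAb]
  have hf₀' : Frame d t b s s₀ :=
    ⟨fun x hx => by
      rw [hf₀.var x (by omega), Store.setReg_reg, if_neg (by omega)],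
      fun x hx => by rw [hf₀.tmp x hx, Store.setReg_reg, if_neg (by omega)],
      fun A hA => by rw [ha₀ A (by omega) (by omega), Store.setReg_arr]⟩
  obtain ⟨s₁, m₁, hr₁, hm₁, hf₁, hv₁⟩ := runs_forLoop (i := 2 * d) (c := .seq c₁ c₂) (s := s₀)
    (n := n) (T := P₁.eval n + P₂.eval n)
    (fun k s' => Frame d t b s s' ∧ ∀ p < n, ∀ q < n, s'.arr b (p * n + q) = iter g T₀ k p q)
    (fun k s' h => (h.1.var 0 hd).trans hs.size)
    ⟨hf₀'.setVar le_rfl _, fun p hp q hq => hv₀ p hp q hq⟩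
    (fun k hk s' ⟨h1, h2⟩ hk' => by
      have hA := (hagree _ s' h1 h2).bindVar hk'
      obtain ⟨s₂, m₂, hr₂, hm₂, hf₂, ha₂, hv₂⟩ := hc₁ n s' _ _ hA
      obtain ⟨s₃, m₃, hr₃, hm₃, hf₃, ha₃, hv₃⟩ := hc₂ n s₂ (bind ρ d k)
        (fun _ p q => s₂.arr (b + 1) (p * n + q))
        ⟨(hf₂.var 0 (by omega)).trans hA.size, fun x hx => (hf₂.var x hx).trans (hA.var x hx),
          fun A hA p _ q _ => by rw [List.mem_singleton.1 hA]⟩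
      have hf := hf₂.trans hf₃
      refine ⟨s₃, _, .seq hr₂ hr₃, by omega, (hf.var d (by omega)).trans hk', ?_, ?_⟩
      · refine (h1.trans ⟨fun x hx => hf.var x (by omega), hf.tmp, fun A hA => ?_⟩).setVar le_rfl _
        rw [ha₃ A (by omega) (by omega), ha₂ A (by omega) (by omega)]
      · intro p hp q hq
        rw [Store.setReg_arr, hv₃ p hp q hq]
        have h' : d + 1 ≠ d + 2 := by omega
        simp only [Tm.val, bind, if_true, if_neg h', hp, hq, and_self]
        exact hv₂ p hp q hq)
  obtain ⟨s₂, m₂, hr₂, hm₂, hf₂, hv₂⟩ := hc₃ n s₁ _ _ (hagree _ s₁ hf₁ hv₁)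
  refine ⟨s₂, _, .seq (.assign _ _ _) (.seq hr₀ (.seq hr₁ hr₂)), ?_,
    hf₁.trans (hf₂.mono le_rfl le_rfl (by omega)), hv₂⟩
  simp only [Polynomial.eval_add, Polynomial.eval_mul, Polynomial.eval_X, Polynomial.eval_C,
    Expr.cost]
  omega

/-- The number of rounds of each loop depends on `n` alone and not on computed values. So the time
bounds compose to a polynomial, even though intermediate values may be as large as powers of two. -/
theorem Tm.Wf.computable (e : Tm) : ∀ {d b : ℕ} {R : List ℕ}, 0 < d → (∀ A ∈ R, A < b) →
    e.Wf d b R → e.Computable d b R := by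
  induction e with
  | const k => exact fun _ _ _ => .const k
  | var x => exact fun _ _ h => .var h
  | get A p q hp hq => exact fun hd hR h => .get hd hR h.1 (hp hd hR h.2.1) (hq hd hR h.2.2)
  | add e f he hf => exact fun hd hR h => .add hd hR (he hd hR h.1) (hf hd hR h.2)
  | sub e f he hf => exact fun hd hR h => .sub hd hR (he hd hR h.1) (hf hd hR h.2)
  | ite c e f hc he hf =>
    exact fun hd hR h => .ite hd hR (hc hd hR h.1) (he hd hR h.2.1) (hf hd hR h.2.2)
  | fold init body hi hb =>
    exact fun hd hR h => .fold hd hR (hi hd hR h.1) (hb (by omega) hR h.2)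
  | table init step res hi hs hr =>
    intro d b R hd hR h
    have hR' : ∀ A ∈ R, A < b + 2 := fun A hA => (hR A hA).trans (by omega)
    have hbR : ∀ A ∈ b :: R, A < b + 2 := by
      intro A hA
      rcases List.mem_cons.1 hA with rfl | hA
      · omega
      · exact hR' A hA
    exact .table hd hR (hi (by omega) hR' h.1) (hs (by omega) hbR h.2.1) (hr hd hbR h.2.2)

open Classical in
/-- A property that is expressed by a term can be decided in polynomial time. -/
theorem Tm.polyTimeDecidableOn (e : Tm) (he : e.Wf 1 1 [0])
    (C P : ∀ {n : ℕ}, SimpleGraph (Fin n) → Prop)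
    (h : ∀ (n : ℕ) (G : SimpleGraph (Fin n)) (ρ : ℕ → ℕ) (τ : ℕ → ℕ → ℕ → ℕ), C G →
      (∀ u v : Fin n, τ 0 u v = if G.Adj u v then 1 else 0) →
      (P G → e.val n 1 1 ρ τ = 1) ∧ (¬ P G → e.val n 1 1 ρ τ = 0)) :
    PolyTimeDecidableOn C P := by
  obtain ⟨c, Q, hc⟩ := Tm.Wf.computable e Nat.one_pos (by simp) he 0
  -- The compiled term leaves its value in register `1` (`t = 0`), whereas the answer is expected in
  -- register `0`.
  refine ⟨.seq c (.assign 0 (.var 1)), Q + Polynomial.C 2, fun n G hG => ?_⟩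
  let τ : ℕ → ℕ → ℕ → ℕ := fun _ p q =>
    if ∃ u v : Fin n, G.Adj u v ∧ p = u ∧ q = v then 1 else 0
  obtain ⟨s, m, hr, hm, -, hv⟩ := hc n (inputStore G) (fun _ => n) τ
    ⟨by simp [inputStore], fun x hx => by simp [inputStore, Nat.lt_one_iff.1 hx], by
      intro A hA p hp q hq
      obtain rfl := List.mem_singleton.1 hA
      simp only [inputStore, true_and, τ]
      refine if_congr (exists_congr fun u => exists_congr fun v => and_congr_right fun _ => ?_)
        rfl rfl
      exact ⟨fun h => add_mul_inj hq v.2 h, fun h => by rw [h.1, h.2]⟩⟩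
  have := h n G (fun _ => n) τ hG fun u v => if_congr
    ⟨fun ⟨u', v', h, hu, hv⟩ => by rwa [Fin.ext hu, Fin.ext hv],
      fun h => ⟨u, v, h, rfl, rfl⟩⟩ rfl rfl
  rw [← hv] at this
  refine ⟨_, _, .seq hr (.assign _ _ _), ?_, ?_⟩
  · simp only [Polynomial.eval_add, Polynomial.eval_C, Expr.cost]; omega
  · simpa [Expr.eval] using this

end Terms
end P3Game

namespace P3Game

/-! ### Branches and hulls as iterated closures -/

section Closure

/-- Each step before stabilization adds a vertex; if `n` steps did not suffice, the next set would
have more than `n` vertices. -/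
theorem iterate_card_fixed {n : ℕ} (Φ : Set (Fin n) → Set (Fin n)) (hΦ : ∀ S, S ⊆ Φ S)
    (S : Set (Fin n)) : Φ (Φ^[n] S) = Φ^[n] S := by
  by_contra hne
  have hne' : ∀ k ≤ n, Φ (Φ^[k] S) ≠ Φ^[k] S := by
    intro k hk h
    apply hne
    obtain ⟨m, rfl⟩ := Nat.exists_eq_add_of_le' hk
    rw [Function.iterate_add_apply, (Function.IsFixedPt.iterate h m).eq, h]
  have hcard : ∀ k ≤ n + 1, k ≤ (Φ^[k] S).ncard := by
    intro k
    induction k with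
    | zero => exact fun _ => Nat.zero_le _
    | succ k ih =>
      intro hk
      have h1 := ih (by omega)
      have h2 : (Φ^[k] S).ncard < (Φ^[k + 1] S).ncard := by
        rw [Function.iterate_succ_apply']
        exact Set.ncard_lt_ncard ((hΦ _).ssubset_of_ne (hne' k (by omega)).symm)
      omega
  have h1 := hcard (n + 1) le_rfl
  have h2 := Set.ncard_le_card (Φ^[n + 1] S)
  rw [Nat.card_fin] at h2
  omega

variable {n : ℕ} (G : SimpleGraph (Fin n))

/-- Add the neighbours other than `u`. -/
def branchStep (u : Fin n) (S : Set (Fin n)) : Set (Fin n) :=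
  {v | v ∈ S ∨ v ≠ u ∧ ∃ x, G.Adj x v ∧ x ∈ S}

/-- Add the vertices with two neighbours in `S`. -/
def hullStep (S : Set (Fin n)) : Set (Fin n) :=
  {v | v ∈ S ∨ ∃ a b, a < b ∧ G.Adj v a ∧ G.Adj v b ∧ a ∈ S ∧ b ∈ S}

theorem branchStep_iterate (u w : Fin n) : (branchStep G u)^[n] {w} = branch G u w := by
  have hsub : ∀ S, S ⊆ branchStep G u S := fun S v hv => Or.inl hv
  apply Set.Subset.antisymm
  · have : ∀ k, (branchStep G u)^[k] {w} ⊆ branch G u w := by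
      intro k
      induction k with
      | zero => rintro _ rfl; exact mem_branch_self _ _
      | succ k ih =>
        rw [Function.iterate_succ_apply']
        rintro v (hv | ⟨hvu, x, hxv, hx⟩)
        · exact ih hv
        · exact branch_adj (ih hx) hxv hvu
    exact this n
  · have hfix := iterate_card_fixed _ hsub {w}
    have hw : ∀ k, w ∈ (branchStep G u)^[k] {w} := by
      intro k
      induction k with
      | zero => rfl
      | succ k ih => rw [Function.iterate_succ_apply']; exact hsub _ ih
    intro v hv
    induction hv with
    | refl => exact hw n
    | @tail c d _ h ih =>
      rw [← hfix]
      exact Or.inr ⟨h.2, c, h.1, ih⟩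

theorem hullStep_iterate (A : Set (Fin n)) : (hullStep G)^[n] A = hull G A := by
  have hsub : ∀ S, S ⊆ hullStep G S := fun S v hv => Or.inl hv
  apply Set.Subset.antisymm
  · have : ∀ k, (hullStep G)^[k] A ⊆ hull G A := by
      intro k
      induction k with
      | zero => exact subset_hull G A
      | succ k ih =>
        rw [Function.iterate_succ_apply']
        rintro v (hv | ⟨a, b, hab, ha, hb, haS, hbS⟩)
        · exact ih hv
        · exact p3Closed_iff.1 (p3Closed_hull G A) v a b ha hb (ih haS) (ih hbS) hab.ne
    exact this n
  · refine hull_subset ?_ ?_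
    · rw [p3Closed_iff]
      intro x a b hxa hxb ha hb hab
      rw [← iterate_card_fixed _ hsub A]
      rcases lt_or_gt_of_ne hab with h | h
      · exact Or.inr ⟨a, b, h, hxa, hxb, ha, hb⟩
      · exact Or.inr ⟨b, a, h, hxb, hxa, hb, ha⟩
    · have : ∀ k, A ⊆ (hullStep G)^[k] A := by
        intro k
        induction k with
        | zero => exact subset_rfl
        | succ k ih => rw [Function.iterate_succ_apply']; exact ih.trans (hsub _)
      exact this n

end Closure

/-! ### Nim-sums by binary digits -/

section Bits

/-- The machine has no bitwise operations; a bit of a nim-sum is a parity, which it can compute. -/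
theorem testBit_nimFold {ι : Type*} (s : Finset ι) (f : ι → ℕ) (j : ℕ) :
    (nimFold s f).testBit j = true ↔ (s.filter fun i => (f i).testBit j = true).card % 2 = 1 := by
  classical
  induction s using Finset.induction_on with
  | empty => simp [nimFold]
  | @insert i s hi ih =>
    rw [nimFold_insert hi, Nat.testBit_xor, Finset.filter_insert]
    by_cases h : (f i).testBit j = true
    · rw [if_pos h, Finset.card_insert_of_notMem (by simp [hi]), h]
      rw [Bool.true_xor, Bool.not_eq_true', ← Bool.not_eq_true, ih]
      omega
    · rw [if_neg h, ← ih, Bool.eq_false_iff.2 h, Bool.false_xor]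

theorem nimFold_lt_two_pow {ι : Type*} (s : Finset ι) (f : ι → ℕ) (n : ℕ) (h : ∀ i, f i < 2 ^ n) :
    nimFold s f < 2 ^ n := by
  classical
  induction s using Finset.induction_on with
  | empty => exact Nat.two_pow_pos n
  | @insert i s hi ih =>
    rw [nimFold_insert hi]
    exact Nat.xor_lt_two_pow (h i) ih

theorem sum_testBit (X n : ℕ) :
    ∑ j ∈ Finset.range n, (if X.testBit j = true then 2 ^ j else 0) = X % 2 ^ n := by
  induction n with
  | zero => simp [Nat.mod_one]
  | succ n ih =>
    rw [Finset.sum_range_succ, ih, Nat.testBit_eq_decide_div_mod_eq, Nat.mod_pow_succ]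
    rcases Nat.mod_two_eq_zero_or_one (X / 2 ^ n) with h | h <;> simp [h]

/-- Bit `j` is set iff the quotient of `m` by `2 ^ j` is an odd number `2 * b + 1`. This form avoids
division, and a search over `b < n` is enough since `m ≤ n`. -/
theorem exists_odd_iff_testBit {n m j : ℕ} (hm : m ≤ n) (hj : j < n) :
    (∃ b : Fin n, (2 * b + 1) * 2 ^ j ≤ m ∧ m < (2 * b + 2) * 2 ^ j) ↔ m.testBit j = true := by
  rw [Nat.testBit_eq_decide_div_mod_eq, decide_eq_true_iff]
  have h2 := Nat.two_pow_pos j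
  constructor
  · rintro ⟨b, h1, h2⟩
    rw [Nat.div_eq_of_lt_le h1 h2]
    omega
  · intro h
    have h3 : m / 2 ^ j ≤ m := Nat.div_le_self _ _
    refine ⟨⟨m / 2 ^ j / 2, by omega⟩, ?_, ?_⟩
    · dsimp only
      rw [show 2 * (m / 2 ^ j / 2) + 1 = m / 2 ^ j by omega]
      exact Nat.div_mul_le_self _ _
    · dsimp only
      rw [show 2 * (m / 2 ^ j / 2) + 2 = m / 2 ^ j + 1 by omega]
      exact (Nat.div_lt_iff_lt_mul h2).1 (Nat.lt_succ_self _)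

theorem iter_sum {n : ℕ} {f : ℕ → ℕ → ℕ} (r : ℕ → ℕ) (h : ∀ i < n, ∀ a, f i a = a + r i) :
    iter f 0 n = ∑ i ∈ Finset.range n, r i := by
  have : ∀ k ≤ n, iter f 0 k = ∑ i ∈ Finset.range k, r i := by
    intro k
    induction k with
    | zero => exact fun _ => rfl
    | succ k ih => intro hk; rw [iter, h k hk, ih (by omega), Finset.sum_range_succ]
  exact this n le_rfl

theorem iter_parity {n : ℕ} {f : ℕ → ℕ → ℕ} (r : Fin n → ℕ) {b : ℕ} (hb : b < 2)
    (h : ∀ i : Fin n, ∀ a < 2, f i a = (a + r i) % 2) :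
    iter f b n = (b + ∑ i, r i) % 2 := by
  have : ∀ k ≤ n, iter f b k =
      (b + ∑ i ∈ Finset.range k, if h : i < n then r ⟨i, h⟩ else 0) % 2 := by
    intro k
    induction k with
    | zero => intro _; simp [iter, Nat.mod_eq_of_lt hb]
    | succ k ih =>
      intro hk
      have h' := h ⟨k, hk⟩
      rw [iter, ih (by omega), h' _ (Nat.mod_lt _ two_pos), Finset.sum_range_succ,
        dif_pos (show k < n from hk)]
      omega
  rw [this n le_rfl, Finset.sum_range]
  simp

theorem iter_double {n j a : ℕ} (hj : j ≤ n) :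
    iter (fun k acc => if j - k ≠ 0 then acc + acc else acc) a n = a * 2 ^ j := by
  have : ∀ k, iter (fun k acc => if j - k ≠ 0 then acc + acc else acc) a k = a * 2 ^ min j k := by
    intro k
    induction k with
    | zero => simp [iter]
    | succ k ih =>
      rw [iter, ih]
      by_cases h : k < j
      · rw [if_pos (by omega), min_eq_right h.le, min_eq_right h, pow_succ]
        ring
      · rw [if_neg (by omega), min_eq_left (by omega), min_eq_left (by omega)]
  rw [this, min_eq_left hj]

end Bits

/-! ### Terms for conditions, sums and nim-sums -/

section Program

namespace Tm

/-! Conditions are terms that are not zero if the condition holds. -/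

def not (e : Tm) : Tm := .sub (.const 1) e
def and (e f : Tm) : Tm := .ite e f (.const 0)
def or (e f : Tm) : Tm := .ite e (.const 1) f
def lt (e f : Tm) : Tm := .sub f e
def le (e f : Tm) : Tm := .sub (.add f (.const 1)) e
def eq (e f : Tm) : Tm := .and (.le e f) (.le f e)
def cell (A x y : ℕ) : Tm := .get A (.var x) (.var y)

/-- Some value of the new variable `d` satisfies `e`. -/
def ex (d : ℕ) (e : Tm) : Tm := .fold (.const 0) (.ite (.var (d + 1)) (.const 1) e)

/-- All values of the new variable `d` satisfy `e`. -/
def all (d : ℕ) (e : Tm) : Tm := .not (.ex d (.not e))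

/-- The sum of `e` over the values of the new variable `d`. -/
def sum (d : ℕ) (e : Tm) : Tm := .fold (.const 0) (.add (.var (d + 1)) e)

end Tm

theorem bind_self (ρ : ℕ → ℕ) (d v : ℕ) : bind ρ d v d = v := if_pos rfl

theorem bind_of_ne {ρ : ℕ → ℕ} {d v x : ℕ} (h : x ≠ d) : bind ρ d v x = ρ x := if_neg h

variable {n d b : ℕ} {ρ : ℕ → ℕ} {τ : ℕ → ℕ → ℕ → ℕ} {e f : Tm}

theorem val_not : e.not.val n d b ρ τ ≠ 0 ↔ ¬ e.val n d b ρ τ ≠ 0 := by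
  simp only [Tm.not, Tm.val]; omega

theorem val_and : (e.and f).val n d b ρ τ ≠ 0 ↔
    e.val n d b ρ τ ≠ 0 ∧ f.val n d b ρ τ ≠ 0 := by
  simp only [Tm.and, Tm.val]
  split_ifs with h <;> simp [h]

theorem val_or : (e.or f).val n d b ρ τ ≠ 0 ↔
    e.val n d b ρ τ ≠ 0 ∨ f.val n d b ρ τ ≠ 0 := by
  simp only [Tm.or, Tm.val]
  split_ifs with h <;> simp [h]

theorem val_lt : (e.lt f).val n d b ρ τ ≠ 0 ↔ e.val n d b ρ τ < f.val n d b ρ τ := by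
  simp only [Tm.lt, Tm.val]; omega

theorem val_le : (e.le f).val n d b ρ τ ≠ 0 ↔ e.val n d b ρ τ ≤ f.val n d b ρ τ := by
  simp only [Tm.le, Tm.val]; omega

theorem val_eq : (e.eq f).val n d b ρ τ ≠ 0 ↔ e.val n d b ρ τ = f.val n d b ρ τ := by
  rw [Tm.eq, val_and, val_le, val_le]; omega

/-- The body is evaluated only as long as no witness has been found, which is why the accumulator
variable `d + 1` has the value `0` in it. -/
theorem val_ex : (e.ex d).val n d b ρ τ ≠ 0 ↔
    ∃ i : Fin n, e.val n (d + 2) b (bind (bind ρ d i) (d + 1) 0) τ ≠ 0 := by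
  have : ∀ k, iter (fun i acc => (Tm.ite (.var (d + 1)) (.const 1) e).val n (d + 2) b
      (bind (bind ρ d i) (d + 1) acc) τ) 0 k ≠ 0 ↔
      ∃ i < k, e.val n (d + 2) b (bind (bind ρ d i) (d + 1) 0) τ ≠ 0 := by
    intro k
    induction k with
    | zero => simp [iter]
    | succ k ih =>
      rw [iter, Tm.val]
      simp only [Tm.val, bind_self] at ih ⊢
      split_ifs with h
      · refine iff_of_true Nat.one_ne_zero ?_
        obtain ⟨i, hi, hv⟩ := ih.1 h
        exact ⟨i, by omega, hv⟩
      · have h0 := not_not.1 h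
        rw [h0]
        constructor
        · exact fun h' => ⟨k, by omega, h'⟩
        · rintro ⟨i, hi, hv⟩
          rcases Nat.lt_succ_iff_lt_or_eq.1 hi with hi | rfl
          · exact absurd (ih.2 ⟨i, hi, hv⟩) h
          · exact hv
  rw [Fin.exists_iff]
  simp only [exists_prop]
  exact this n

theorem val_all : (e.all d).val n d b ρ τ ≠ 0 ↔
    ∀ i : Fin n, e.val n (d + 2) b (bind (bind ρ d i) (d + 1) 0) τ ≠ 0 := by
  rw [Tm.all, val_not, val_ex]
  simp only [val_not, not_exists, not_not]

theorem val_sum {r : ℕ → ℕ}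
    (h : ∀ i < n, ∀ a, e.val n (d + 2) b (bind (bind ρ d i) (d + 1) a) τ = r i) :
    (e.sum d).val n d b ρ τ = ∑ i ∈ Finset.range n, r i := by
  rw [Tm.sum, Tm.val]
  refine iter_sum r fun i hi a => ?_
  rw [Tm.val, h i hi a, Tm.val, bind_self]

theorem val_cell {A x y : ℕ} {u v : Fin n} (hx : ρ x = u) (hy : ρ y = v) :
    (Tm.cell A x y).val n d b ρ τ = τ A u v := by
  simp [Tm.cell, Tm.val, hx, hy]

namespace Tm

/-- The value of `e` times two to the power of variable `j`. -/
def shift (d j : ℕ) (e : Tm) : Tm :=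
  .fold e (.ite (.lt (.var d) (.var j)) (.add (.var (d + 1)) (.var (d + 1))) (.var (d + 1)))

/-- Bit `j` of the entry `(x, y)` of table `A`. -/
def bit (d A x y j : ℕ) : Tm :=
  .ex d (.and (.le (.shift (d + 2) j (.add (.add (.var d) (.var d)) (.const 1))) (.cell A x y))
    (.lt (.cell A x y) (.shift (d + 2) j (.add (.add (.var d) (.var d)) (.const 2)))))

/-- The parity of bit `j` of the nim-sum for the set in row `x` of table `A`. The tables `1` and
`3` hold the representatives and the values of the branches. -/
def nimBit (d A x j : ℕ) : Tm :=
  .fold (.const 0) (.fold (.var (d + 1)) (.ite (.and (.cell 1 d (d + 2)) (.and (.cell A x d)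
    (.and (.not (.cell A x (d + 2))) (.bit (d + 4) 3 d (d + 2) j))))
    (.sub (.const 1) (.var (d + 3))) (.var (d + 3))))

/-- The nim-sum for the set in row `x` of table `A`. -/
def nim (d A x : ℕ) : Tm :=
  .sum d (.ite (.nimBit (d + 2) A x d) (.shift (d + 2) d (.const 1)) (.const 0))

end Tm

theorem val_shift {j : ℕ} (hj : ρ j ≤ n) (hjd : j < d) :
    (e.shift d j).val n d b ρ τ = e.val n d b ρ τ * 2 ^ ρ j := by
  rw [Tm.shift, Tm.val, ← iter_double hj]
  congr 1
  funext k acc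
  simp (disch := omega) only [Tm.val, Tm.lt, bind_self, bind_of_ne]

theorem val_bit {A x y j : ℕ} {u v : Fin n} (hx : ρ x = u) (hy : ρ y = v) (hj : ρ j < n)
    (hxd : x < d) (hyd : y < d) (hjd : j < d) (hm : τ A u v ≤ n) :
    (Tm.bit d A x y j).val n d b ρ τ ≠ 0 ↔ (τ A u v).testBit (ρ j) = true := by
  rw [← exists_odd_iff_testBit hm hj, Tm.bit, val_ex]
  refine exists_congr fun i => ?_
  have hj' : bind (bind ρ d i) (d + 1) 0 j = ρ j := by simp (disch := omega) only [bind_of_ne]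
  rw [val_and, val_le, val_lt, val_shift (by rw [hj']; omega) (by omega),
    val_shift (by rw [hj']; omega) (by omega), hj',
    val_cell (u := u) (v := v) (by simp (disch := omega) only [bind_of_ne, hx])
      (by simp (disch := omega) only [bind_of_ne, hy])]
  simp (disch := omega) only [Tm.val, bind_self, bind_of_ne, two_mul]

theorem val_nimBit {G : SimpleGraph (Fin n)} {γ : Fin n → Fin n → ℕ} {S : Set (Fin n)}
    {A x j : ℕ} {y : Fin n} (hx : ρ x = y) (hj : ρ j < n) (hxd : x < d) (hjd : j < d)
    (h1 : ∀ u v : Fin n, τ 1 u v ≠ 0 ↔ IsRep G u v) (h3 : ∀ u v : Fin n, τ 3 u v = γ u v)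
    (hγ : ∀ u v, γ u v ≤ n) (hS : ∀ v : Fin n, τ A y v ≠ 0 ↔ v ∈ S) :
    (Tm.nimBit d A x j).val n d b ρ τ ≠ 0 ↔ (nimSum G γ S).testBit (ρ j) = true := by
  classical
  -- The inner loop starts from the accumulator of the outer one, so a single parity bit runs
  -- through all pairs and is flipped by `1 - acc`.
  have key : (Tm.nimBit d A x j).val n d b ρ τ = (0 + ∑ u : Fin n, ∑ v : Fin n,
      if (IsRep G u v ∧ u ∈ S ∧ v ∉ S) ∧ (γ u v).testBit (ρ j) = true then 1 else 0) % 2 := by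
    rw [Tm.nimBit, Tm.val]
    refine iter_parity _ (by simp [Tm.val]) fun u a ha => ?_
    rw [Tm.val]
    have ha' : (Tm.var (d + 1)).val n (d + 2) b (bind (bind ρ d u) (d + 1) a) τ = a := by
      rw [Tm.val, bind_self]
    rw [ha']
    refine iter_parity _ ha fun v a' ha' => ?_
    have hcond : (Tm.and (.cell 1 d (d + 2)) (.and (.cell A x d) (.and (.not (.cell A x (d + 2)))
        (.bit (d + 4) 3 d (d + 2) j)))).val n (d + 2 + 2) b (bind (bind (bind (bind ρ d u) (d + 1) a)
          (d + 2) v) (d + 2 + 1) a') τ ≠ 0 ↔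
          (IsRep G u v ∧ u ∈ S ∧ v ∉ S) ∧ (γ u v).testBit (ρ j) = true := by
      have e1 : bind (bind (bind (bind ρ d u) (d + 1) a) (d + 2) v) (d + 2 + 1) a' d = u := by
        simp (disch := omega) only [bind_of_ne, bind_self]
      have e2 : bind (bind (bind (bind ρ d u) (d + 1) a) (d + 2) v) (d + 2 + 1) a' (d + 2) = v := by
        simp (disch := omega) only [bind_of_ne, bind_self]
      have e3 : bind (bind (bind (bind ρ d u) (d + 1) a) (d + 2) v) (d + 2 + 1) a' x = y := by
        simp (disch := omega) only [bind_of_ne, hx]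
      have e4 : bind (bind (bind (bind ρ d u) (d + 1) a) (d + 2) v) (d + 2 + 1) a' j = ρ j := by
        simp (disch := omega) only [bind_of_ne]
      rw [val_and, val_and, val_and, val_not, val_cell e1 e2, val_cell e3 e1, val_cell e3 e2,
        val_bit e1 e2 (by rw [e4]; exact hj) (by omega) (by omega) (by omega)
          (by rw [h3]; exact hγ u v), e4, h1, hS, hS, h3]
      simp only [and_assoc]
    have e5 : bind (bind (bind (bind ρ d u) (d + 1) a) (d + 2) v) (d + 2 + 1) a' (d + 3) = a' :=
      bind_self _ _ _
    rw [Tm.val]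
    simp only [hcond]
    simp only [Tm.val, e5]
    split_ifs <;> omega
  rw [key, nimSum, testBit_nimFold, cross, Finset.filter_filter, Finset.card_filter,
    Fintype.sum_prod_type, Nat.zero_add, Nat.mod_two_ne_zero]

theorem val_nim {G : SimpleGraph (Fin n)} {γ : Fin n → Fin n → ℕ} {S : Set (Fin n)}
    {A x : ℕ} {y : Fin n} (hx : ρ x = y) (hxd : x < d)
    (h1 : ∀ u v : Fin n, τ 1 u v ≠ 0 ↔ IsRep G u v) (h3 : ∀ u v : Fin n, τ 3 u v = γ u v)
    (hγ : ∀ u v, γ u v ≤ n) (hS : ∀ v : Fin n, τ A y v ≠ 0 ↔ v ∈ S) :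
    (Tm.nim d A x).val n d b ρ τ = nimSum G γ S := by
  -- The values are at most `n < 2 ^ n`, so the bits below `n` determine the nim-sum.
  have hlt : nimSum G γ S < 2 ^ n :=
    nimFold_lt_two_pow _ _ _ fun p => (hγ _ _).trans_lt Nat.lt_two_pow_self
  rw [← Nat.mod_eq_of_lt hlt, ← sum_testBit, Tm.nim]
  refine val_sum fun j hj a => ?_
  have e1 : bind (bind ρ d j) (d + 1) a d = j := by
    simp (disch := omega) only [bind_of_ne, bind_self]
  have e2 : bind (bind ρ d j) (d + 1) a x = y := by
    simp (disch := omega) only [bind_of_ne, hx]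
  rw [Tm.val, val_shift (by rw [e1]; omega) (by omega), e1, Tm.val, Nat.one_mul, Tm.val]
  refine if_congr ?_ rfl rfl
  rw [val_nimBit e2 (by rw [e1]; exact hj) (by omega) (by omega) h1 h3 hγ hS, e1]

end Program

end P3Game

namespace P3Game

/-! ### The algorithm as a term and its correctness -/

section Algorithm

namespace Tm

/-- Evaluate `res` with a new table of the branches at the vertex in variable `2`: row `w` is the
branch that contains `w`. -/
def withBranches (A : ℕ) (res : Tm) : Tm :=
  .table (.eq (.var 6) (.var 5))
    (.or (.cell A 5 6) (.and (.not (.eq (.var 6) (.var 2)))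
      (.ex 7 (.and (.cell 0 7 6) (.cell A 5 7))))) res

/-- Evaluate `res` with table `7`, in which row `y` is the hull of `y` and the vertices outside
the branch in variables `2` and `3`. -/
def withHulls (res : Tm) : Tm :=
  .table (.or (.eq (.var 6) (.var 5)) (.not (.cell 5 3 6)))
    (.or (.cell 7 5 6) (.ex 7 (.ex 9 (.and (.lt (.var 7) (.var 9)) (.and (.cell 0 6 7)
      (.and (.cell 0 6 9) (.and (.cell 7 5 7) (.cell 7 5 9)))))))) res

/-- Variable `3` is a representative of a branch at variable `2`. -/
def isRep : Tm :=
  .and (.cell 0 2 3) (.all 4 (.not (.and (.lt (.var 4) (.var 3))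
    (.and (.cell 0 2 4) (.cell 3 3 4)))))

/-- Variable `8` lies in the branch, near its root. -/
def isMove : Tm :=
  .and (.cell 5 3 8) (.or (.cell 0 2 8) (.ex 10 (.and (.cell 0 2 10) (.cell 0 10 8))))

/-- The least number that is not the nim-sum after a move in the branch. -/
def mex : Tm :=
  .sum 4 (.ite (.all 6 (.or (.lt (.var 4) (.var 6))
    (.ex 8 (.and isMove (.eq (.nim 10 7 8) (.var 6)))))) (.const 1) (.const 0))

/-- Evaluate `res` with table `1` of the representatives. -/
def withReps (res : Tm) : Tm :=
  .table (.withBranches 3 isRep) (.cell 1 2 3) res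

/-- Evaluate `res` with table `3` of the values of the branches. -/
def withValues (res : Tm) : Tm :=
  .table (.const 0) (.withBranches 5 (.withHulls mex)) res

/-- Evaluate `res` with table `5`, in which row `x` contains only `x`. -/
def withSingletons (res : Tm) : Tm :=
  .table (.eq (.var 3) (.var 2)) (.cell 5 2 3) res

/-- The first player wins. -/
def firstPlayerWins : Tm :=
  .withReps (.withValues (.withSingletons
    (.ite (.ex 1 (.eq (.nim 3 5 1) (.const 0))) (.const 1) (.const 0))))

end Tm

theorem wf_firstPlayerWins : Tm.firstPlayerWins.Wf 1 1 [0] := by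
  simp [Tm.firstPlayerWins, Tm.withReps, Tm.withValues, Tm.withSingletons, Tm.withBranches,
    Tm.withHulls, Tm.isRep, Tm.isMove, Tm.mex, Tm.nim, Tm.nimBit, Tm.bit, Tm.shift, Tm.sum, Tm.ex,
    Tm.all, Tm.cell, Tm.eq, Tm.lt, Tm.le, Tm.and, Tm.or, Tm.not, Tm.Wf]

variable {n : ℕ} {G : SimpleGraph (Fin n)} {ρ : ℕ → ℕ} {τ : ℕ → ℕ → ℕ → ℕ}

theorem bindTable_self (A : ℕ) (T : ℕ → ℕ → ℕ) : bindTable τ A T A = T := if_pos rfl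

theorem bindTable_of_ne {A B : ℕ} {T : ℕ → ℕ → ℕ} (h : B ≠ A) : bindTable τ A T B = τ B :=
  if_neg h

/-- The tables computed by iterating an operation on sets. -/
theorem iter_ne_zero_iff {f : ℕ → (ℕ → ℕ → ℕ) → ℕ → ℕ → ℕ} {T₀ : ℕ → ℕ → ℕ}
    {Φ : Set (Fin n) → Set (Fin n)} {S₀ : Fin n → Set (Fin n)}
    (h₀ : ∀ p q : Fin n, T₀ p q ≠ 0 ↔ q ∈ S₀ p)
    (h : ∀ k T (S : Fin n → Set (Fin n)), (∀ p q : Fin n, T p q ≠ 0 ↔ q ∈ S p) →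
      ∀ p q : Fin n, f k T p q ≠ 0 ↔ q ∈ Φ (S p)) (k : ℕ) :
    ∀ p q : Fin n, iter f T₀ k p q ≠ 0 ↔ q ∈ Φ^[k] (S₀ p) := by
  induction k with
  | zero => exact h₀
  | succ k ih =>
    intro p q
    rw [iter, Function.iterate_succ_apply']
    exact h k _ (fun p => Φ^[k] (S₀ p)) ih p q

/-- The `n` rounds of the table are the `n` iterates of `branchStep`, applied to all rows at once;
`A ≠ 0` keeps the adjacency matrix readable. -/
theorem val_withBranches {A : ℕ} (hA : A ≠ 0) {u : Fin n} (hu : ρ 2 = u)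
    (h0 : ∀ u v : Fin n, τ 0 u v ≠ 0 ↔ G.Adj u v) :
    ∃ T : ℕ → ℕ → ℕ, (∀ w v : Fin n, T w v ≠ 0 ↔ v ∈ branch G u w) ∧
      ∀ res, (Tm.withBranches A res).val n 4 A ρ τ = res.val n 4 (A + 2) ρ (bindTable τ A T) := by
  refine ⟨_, ?_, fun res => by rw [Tm.withBranches, Tm.val]⟩
  simp only [← branchStep_iterate]
  refine iter_ne_zero_iff (fun p q => ?_) (fun k T S hT p q => ?_) n
  · rw [val_eq]
    simp [Tm.val, bind, Fin.ext_iff]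
  · have e5 : bind (bind (bind ρ 4 k) (4 + 1) p) (4 + 2) q 5 = p := rfl
    have e6 : bind (bind (bind ρ 4 k) (4 + 1) p) (4 + 2) q 6 = q := rfl
    have e2 : bind (bind (bind ρ 4 k) (4 + 1) p) (4 + 2) q 2 = u := hu
    rw [val_or, val_and, val_not, val_eq, val_ex, val_cell e5 e6, Tm.val, Tm.val, e6, e2,
      bindTable_self, hT]
    have : ∀ i : Fin n, (Tm.and (.cell 0 7 6) (.cell A 5 7)).val n (4 + 3 + 2) (A + 2)
        (bind (bind (bind (bind (bind ρ 4 k) (4 + 1) p) (4 + 2) q) 7 i) (7 + 1) 0)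
        (bindTable τ A T) ≠ 0 ↔ G.Adj i q ∧ i ∈ S p := by
      intro i
      rw [val_and, val_cell (u := i) (v := q) rfl rfl, val_cell (u := p) (v := i) rfl rfl,
        bindTable_of_ne hA.symm, h0, bindTable_self, hT]
    simp only [this, branchStep, Set.mem_ofPred_eq, Fin.ext_iff, ne_eq]

theorem val_withHulls {u w : Fin n} (hw : ρ 3 = w)
    (h0 : ∀ u v : Fin n, τ 0 u v ≠ 0 ↔ G.Adj u v)
    (h5 : ∀ v : Fin n, τ 5 w v ≠ 0 ↔ v ∈ branch G u w) :
    ∃ T : ℕ → ℕ → ℕ, (∀ y v : Fin n, T y v ≠ 0 ↔ v ∈ hull G (insert y (branch G u w)ᶜ)) ∧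
      ∀ res, (Tm.withHulls res).val n 4 7 ρ τ = res.val n 4 9 ρ (bindTable τ 7 T) := by
  refine ⟨_, ?_, fun res => by rw [Tm.withHulls, Tm.val]⟩
  simp only [← hullStep_iterate]
  refine iter_ne_zero_iff (fun p q => ?_) (fun k T S hT p q => ?_) n
  · have e5 : bind (bind (bind ρ 4 0) (4 + 1) p) (4 + 2) q 5 = p := rfl
    have e6 : bind (bind (bind ρ 4 0) (4 + 1) p) (4 + 2) q 6 = q := rfl
    have e3 : bind (bind (bind ρ 4 0) (4 + 1) p) (4 + 2) q 3 = w := hw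
    rw [val_or, val_not, val_eq, val_cell e3 e6, Tm.val, Tm.val, e5, e6, h5, Fin.val_inj]
    rfl
  · have e5 : bind (bind (bind ρ 4 k) (4 + 1) p) (4 + 2) q 5 = p := rfl
    have e6 : bind (bind (bind ρ 4 k) (4 + 1) p) (4 + 2) q 6 = q := rfl
    rw [val_or, val_ex, val_cell e5 e6, bindTable_self, hT]
    refine or_congr_right (exists_congr fun a => ?_)
    rw [val_ex]
    refine exists_congr fun b => ?_
    rw [val_and, val_and, val_and, val_and, val_lt, val_cell (u := q) (v := a) rfl rfl,
      val_cell (u := q) (v := b) rfl rfl, val_cell (u := p) (v := a) rfl rfl,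
      val_cell (u := p) (v := b) rfl rfl, bindTable_self, hT, hT,
      bindTable_of_ne (by norm_num), h0, h0]
    rfl

theorem val_isRep {u w : Fin n} (hu : ρ 2 = u) (hw : ρ 3 = w)
    (h0 : ∀ u v : Fin n, τ 0 u v ≠ 0 ↔ G.Adj u v)
    (h3 : ∀ v : Fin n, τ 3 w v ≠ 0 ↔ v ∈ branch G u w) :
    Tm.isRep.val n 4 5 ρ τ ≠ 0 ↔ IsRep G u w := by
  rw [Tm.isRep, val_and, val_cell hu hw, h0, val_all, IsRep]
  refine and_congr_right fun _ => forall_congr' fun v => ?_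
  have e2 : bind (bind ρ 4 v) (4 + 1) 0 2 = u := hu
  have e3 : bind (bind ρ 4 v) (4 + 1) 0 3 = w := hw
  have e4 : bind (bind ρ 4 v) (4 + 1) 0 4 = v := rfl
  rw [val_not, val_and, val_and, val_lt, val_cell e2 e4, val_cell e3 e4, h0, h3, Tm.val, Tm.val,
    e4, e3, Fin.val_fin_lt]
  tauto

/-- A table is always recomputed `n` times; here the entries are final from the start and each round
merely copies them, an iteration of `id`. -/
theorem val_withReps (h0 : ∀ u v : Fin n, τ 0 u v ≠ 0 ↔ G.Adj u v) :
    ∃ T : ℕ → ℕ → ℕ, (∀ u v : Fin n, T u v ≠ 0 ↔ IsRep G u v) ∧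
      ∀ res, (Tm.withReps res).val n 1 1 ρ τ = res.val n 1 3 ρ (bindTable τ 1 T) := by
  refine ⟨_, ?_, fun res => by rw [Tm.withReps, Tm.val]⟩
  have := iter_ne_zero_iff (Φ := id) (S₀ := fun u => {w | IsRep G u w}) (n := n)
    (f := fun j T p q => (Tm.cell 1 2 3).val n (1 + 3) (1 + 2)
      (bind (bind (bind ρ 1 j) (1 + 1) p) (1 + 2) q) (bindTable τ 1 T))
    (T₀ := fun p q => (Tm.withBranches 3 .isRep).val n (1 + 3) (1 + 2)
      (bind (bind (bind ρ 1 0) (1 + 1) p) (1 + 2) q) τ)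
    (fun p q => ?_) (fun k T S hT p q => ?_) n
  · simpa using this
  · obtain ⟨T, hT, hres⟩ := val_withBranches (A := 3)
      (ρ := bind (bind (bind ρ 1 0) (1 + 1) p) (1 + 2) q) (by norm_num) (u := p) rfl h0
    refine (Eq.congr_left (hres _)).not.trans ?_
    exact val_isRep rfl rfl h0 fun v => hT q v
  · rw [val_cell (u := p) (v := q) rfl rfl, bindTable_self]
    exact hT p q

theorem val_isMove {u w y : Fin n} (hu : ρ 2 = u) (hw : ρ 3 = w) (hy : ρ 8 = y)
    (h0 : ∀ u v : Fin n, τ 0 u v ≠ 0 ↔ G.Adj u v)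
    (h5 : ∀ v : Fin n, τ 5 w v ≠ 0 ↔ v ∈ branch G u w) :
    Tm.isMove.val n 10 9 ρ τ ≠ 0 ↔ y ∈ branch G u w ∧ Near G {u} y := by
  have hN : Near G {u} y ↔ G.Adj u y ∨ ∃ v, G.Adj u v ∧ G.Adj v y := by simp [Near]
  rw [hN, Tm.isMove, val_and, val_or, val_ex, val_cell hw hy, val_cell hu hy, h5, h0]
  refine and_congr_right fun _ => or_congr_right (exists_congr fun v => ?_)
  have e2 : bind (bind ρ 10 v) (10 + 1) 0 2 = u := hu
  have e8 : bind (bind ρ 10 v) (10 + 1) 0 8 = y := hy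
  rw [val_and, val_cell e2 (v := v) rfl, val_cell (u := v) rfl e8, h0, h0]

/-- `boundedMex` counts the `m < n` such that all numbers up to `m` are options, so it is a sum of
indicators. In the term, variable `4` is `m`, variable `6` a number to be tested, and variable `8`
the move. -/
theorem val_mex {γ : Fin n → Fin n → ℕ} {u w : Fin n} (hu : ρ 2 = u) (hw : ρ 3 = w)
    (hγ : ∀ u v, γ u v ≤ n)
    (h0 : ∀ u v : Fin n, τ 0 u v ≠ 0 ↔ G.Adj u v)
    (h1 : ∀ u v : Fin n, τ 1 u v ≠ 0 ↔ IsRep G u v) (h3 : ∀ u v : Fin n, τ 3 u v = γ u v)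
    (h5 : ∀ v : Fin n, τ 5 w v ≠ 0 ↔ v ∈ branch G u w)
    (h7 : ∀ y v : Fin n, τ 7 y v ≠ 0 ↔ v ∈ hull G (insert y (branch G u w)ᶜ)) :
    Tm.mex.val n 4 9 ρ τ = boundedMex n (options G γ u w) := by
  classical
  rw [boundedMex, Finset.card_filter, Tm.mex]
  refine val_sum fun m hm a => ?_
  rw [Tm.val]
  refine if_congr ?_ rfl rfl
  rw [val_all, Fin.forall_iff]
  refine forall_congr' fun m' => forall_congr' fun hm' => ?_
  rw [val_or, val_lt, val_ex, or_iff_not_imp_left]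
  have e1 : (Tm.var 4).val n (4 + 2 + 2) 9 (bind (bind (bind (bind ρ 4 m) (4 + 1) a) 6 m') (6 + 1) 0)
    τ = m := rfl
  have e2 : (Tm.var 6).val n (4 + 2 + 2) 9 (bind (bind (bind (bind ρ 4 m) (4 + 1) a) 6 m') (6 + 1) 0)
    τ = m' := rfl
  rw [e1, e2, not_lt]
  refine imp_congr_right fun _ => exists_congr fun y => ?_
  refine val_and.trans (and_congr (val_isMove hu hw rfl h0 h5) ?_)
  rw [val_eq, val_nim (y := y) rfl (by norm_num) h1 h3 hγ (h7 y)]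
  rfl

/-- The rounds of this table are the rounds of `grundyIter`. Each entry recomputes the branches and
hulls that belong to it, at polynomial cost. -/
theorem val_withValues (h0 : ∀ u v : Fin n, τ 0 u v ≠ 0 ↔ G.Adj u v)
    (h1 : ∀ u v : Fin n, τ 1 u v ≠ 0 ↔ IsRep G u v) :
    ∃ T : ℕ → ℕ → ℕ, (∀ u v : Fin n, T u v = grundyIter G n u v) ∧
      ∀ res, (Tm.withValues res).val n 1 3 ρ τ = res.val n 1 5 ρ (bindTable τ 3 T) := by
  refine ⟨_, ?_, fun res => by rw [Tm.withValues, Tm.val]⟩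
  suffices ∀ k, ∀ u w : Fin n, iter (fun j T p q => (Tm.withBranches 5 (.withHulls .mex)).val n
      (1 + 3) (3 + 2) (bind (bind (bind ρ 1 j) (1 + 1) p) (1 + 2) q) (bindTable τ 3 T))
      (fun p q => (Tm.const 0).val n (1 + 3) (3 + 2)
        (bind (bind (bind ρ 1 0) (1 + 1) p) (1 + 2) q) τ) k u w = grundyIter G k u w from this n
  intro k
  induction k with
  | zero => exact fun _ _ => rfl
  | succ k ih =>
    intro u w
    rw [iter]
    generalize iter _ _ k = T at ih ⊢
    obtain ⟨T₅, h5, hres5⟩ := val_withBranches (A := 5) (G := G) (τ := bindTable τ 3 T)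
      (ρ := bind (bind (bind ρ 1 k) (1 + 1) u) (1 + 2) w) (by norm_num) (u := u) rfl h0
    obtain ⟨T₇, h7, hres7⟩ := val_withHulls (G := G) (τ := bindTable (bindTable τ 3 T) 5 T₅)
      (ρ := bind (bind (bind ρ 1 k) (1 + 1) u) (1 + 2) w) (u := u) (w := w) rfl h0 (h5 w)
    refine (hres5 _).trans ((hres7 _).trans ?_)
    exact val_mex rfl rfl (grundyIter_le k) h0 h1 ih (h5 w) h7

theorem val_withSingletons : ∃ T : ℕ → ℕ → ℕ,
    (∀ x v : Fin n, T x v ≠ 0 ↔ v ∈ ({x} : Set (Fin n))) ∧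
      ∀ res, (Tm.withSingletons res).val n 1 5 ρ τ = res.val n 1 7 ρ (bindTable τ 5 T) := by
  refine ⟨_, ?_, fun res => by rw [Tm.withSingletons, Tm.val]⟩
  have := iter_ne_zero_iff (Φ := id) (S₀ := fun u : Fin n => {u}) (n := n)
    (f := fun j T p q => (Tm.cell 5 2 3).val n (1 + 3) (5 + 2)
      (bind (bind (bind ρ 1 j) (1 + 1) p) (1 + 2) q) (bindTable τ 5 T))
    (T₀ := fun p q => (Tm.eq (.var 3) (.var 2)).val n (1 + 3) (5 + 2)
      (bind (bind (bind ρ 1 0) (1 + 1) p) (1 + 2) q) τ)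
    (fun p q => ?_) (fun k T S hT p q => ?_) n
  · simpa using this
  · rw [val_eq, Set.mem_singleton_iff, Fin.ext_iff]
    rfl
  · rw [val_cell (u := p) (v := q) rfl rfl, bindTable_self]
    exact hT p q

open Classical in
theorem val_firstPlayerWins (h0 : ∀ u v : Fin n, τ 0 u v ≠ 0 ↔ G.Adj u v) :
    Tm.firstPlayerWins.val n 1 1 ρ τ =
      if ∃ x, nimSum G (grundyIter G n) {x} = 0 then 1 else 0 := by
  obtain ⟨T₁, h1, hres1⟩ := val_withReps (ρ := ρ) h0
  obtain ⟨T₃, h3, hres3⟩ := val_withValues (ρ := ρ) (τ := bindTable τ 1 T₁) h0 h1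
  obtain ⟨T₅, h5, hres5⟩ := val_withSingletons (n := n) (ρ := ρ)
    (τ := bindTable (bindTable τ 1 T₁) 3 T₃)
  rw [Tm.firstPlayerWins, hres1, hres3, hres5, Tm.val]
  refine if_congr ?_ rfl rfl
  rw [val_ex]
  refine exists_congr fun x => ?_
  rw [val_eq, val_nim (y := x) rfl (by norm_num) h1 h3 (grundyIter_le n) (h5 x)]
  rfl

theorem polyTimeDecidableOn_firstPlayerWins :
    PolyTimeDecidableOn (fun G => G.Connected ∧ IsChordal G) (fun G => FirstPlayerWins G) := by
  classical
  refine Tm.polyTimeDecidableOn _ wf_firstPlayerWins _ _ fun n G ρ τ ⟨hconn, hG⟩ hτ => ?_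
  rw [val_firstPlayerWins (G := G) fun u v => by simp [hτ], firstPlayerWins_iff hG hconn]
  exact ⟨fun h => if_pos h, fun h => if_neg h⟩

end Algorithm

end P3Game

theorem mainTheorem2 :
    P3Game.PolyTimeDecidableOn
      (fun G => G.Connected ∧ P3Game.IsChordal G) (fun G => P3Game.FirstPlayerWins G) ∧
    ∀ (V : Type*) [Finite V] (G : SimpleGraph V),
      P3Game.IsBiconnected G → P3Game.IsChordal G →
      ∀ x y : V, x ≠ y → G.dist x y ≤ 2 → P3Game.hull G {x, y} = Set.univ :=
  ⟨P3Game.polyTimeDecidableOn_firstPlayerWins, fun _ _ _ hb hG _ _ hxy hd =>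
    P3Game.hull_pair_eq_univ hb hG hxy hd⟩
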